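/- Let $(\Omega,\mathcal F)$ be a measurable space and let $\phi:\mathbb R\to\mathbb R\cup\{+\infty\}$ be convex and lower semicontinuous (lsc), finite in a neighbourhood of $1$, with $\phi(1)=0$, normalized so that $\phi\ge 0$ and $\phi=+\infty$ on $(-\infty,0)$. Put $\phi'(\infty)=\lim_{x\to\infty}\phi(x)/x$, and for probability measures $\mu,\nu$ let $D(\mu\|\nu)=\int\phi\big(\tfrac{d\mu_c}{d\nu}\big)\,d\nu+\mu_s(\Omega)\,\phi'(\infty)$ (with $0\cdot\infty=0$), where $\mu=\mu_c+\mu_s$ is the Lebesgue decomposition of $\mu$ with respect to $\nu$. Write $\mu(g)=\int g\,d\mu$. For a set $\mathcal G$ of measurable functions let $\mathrm{IPM}_{\mathcal G}(\mu,\nu)=\sup_{g\in\mathcal G}|\mu(g)-\nu(g)|\in[0,\infty]$, with value $+\infty$ if some $g\in\mathcal G$ is not $\mu$- or not $\nu$-integrable. Let $\psi(x)=\phi(x+1)$ and let $\psi^\star$ be its convex conjugate. For a probability measure $\nu$ and a measurable function $g$ define the cumulant generating function $$K_{g,\nu}(t)=\inf\Big\{\int\psi^\star(tg+\lambda)\,d\nu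 \;:\; \lambda\in\mathbb R,\ \lambda+\operatorname{ess\,sup}_\nu(tg)\le\phi'(\infty)\Big\},\qquad t\in\mathbb R .$$ All suprema, infima and conjugates are taken in $[-\infty,\infty]$. Let $X$ be a vector space of finite signed measures on $\Omega$, let $\Xi$ be the $\sigma$-ideal of the measurable sets that are null for every measure in $X$, and let $Y$ be a vector space of measurable functions modulo equality outside of a set in $\Xi$. Assume that $(\mu,h)\mapsto\mu(h)$ is finite and puts $X$ and $Y$ in separating duality. Let $X^1$ be the set of probability measures in $X$. Assume that $(X,Y)$ is decomposable with respect to every $\nu\in X^1$, that is: $X$ contains all measures $\mu\ll\nu$ with $d\mu/d\nu\in L^\infty(\nu)$; $Y$ contains every measurable function whose $\Xi$-essential range is bounded; and every measurable $A\notin\Xi$ carries a nonzero nonnegative $\mu\in X$ with $\mu(\Omega\setminus A)=0$. For $\mathcal G\subseteq Y$ and $\varepsilon\in\mathbb R$ let $L_{\mathcal G}(\varepsilon)$ be the infimum of $D(\mu\|\nu)$ over the $\mu,\nu\in X^1$ with $\sup_{g\in\mathcal G}(\mu(g)-\nu(g))=\varepsilon$ if $\varepsilon\ge0$, and with $\inf_{g\in\mathcal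 G}(\mu(g)-\nu(g))=\varepsilon$ if $\varepsilon<0$. Write $L_g=L_{\{g\}}$. **Theorem.** (1) For every $\mathcal G\subseteq Y$, $$\Big(\inf_{g\in\mathcal G}L_g\Big)^\star=\sup_{g\in\mathcal G,\ \nu\in X^1}K_{g,\nu}.$$ If moreover $\mathrm{IPM}_{\mathcal G}(\mu,\nu)<\infty$ for all $\mu,\nu\in X^1$ with $D(\mu\|\nu)<\infty$, then also $(L_{\mathcal G})^\star=\sup_{g\in\mathcal G,\ \nu\in X^1}K_{g,\nu}$. (2) Let $\Sigma$ be any $\sigma$-ideal of measurable sets, let $\mathcal G$ be a nonempty set of measurable functions, and let $P$ be the set of probability measures that vanish on $\Sigma$ and integrate every $g\in\mathcal G$. Let $L:[0,\infty)\to[-\infty,\infty]$ be convex and lsc, put $L(\infty)=\lim_{x\to\infty}L(x)$ and $L^\star(s)=\sup_{x\ge0}(sx-L(x))$, and consider the statements - (i) $D(\mu\|\nu)\ge L(\mathrm{IPM}_{\mathcal G}(\mu,\nu))$ for all $\mu,\nu\in P$; - (ii) $D(\mu\|\nu)\ge L(|\mu(g)-\nu(g)|)$ for all $g\in\mathcal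 G$ and $\mu,\nu\in P$; - (iii) $K_{g,\nu}(t)\le L^\star(|t|)$ for all $t\in\mathbb R$, $g\in\mathcal G$ and $\nu\in P$. Then (i) and (ii) are equivalent and imply (iii). If $L$ never takes the value $-\infty$, and $L$ is nondecreasing or $L(0)\le0$, then (i), (ii) and (iii) are equivalent. (3) In particular (Pinsker's inequality for $\phi$-subgaussian classes), for $\mathcal G$ and $P$ as in (2), $D(\mu\|\nu)\ge\frac12\mathrm{IPM}_{\mathcal G}(\mu,\nu)^2$ for all $\mu,\nu\in P$ if and only if $K_{g,\nu}(t)\le t^2/2$ for all $t\in\mathbb R$, $g\in\mathcal G$ and $\nu\in P$. -/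

import Mathlib

open MeasureTheory Set Filter Topology
open scoped NNReal ENNReal

namespace OptimalIPM

/-! ### Convex analysis on the line, with values in the extended reals -/

/-- Convexity of `f : ℝ → [-∞, ∞]`: the epigraph is convex. -/
def ConvexEReal (f : ℝ → EReal) : Prop :=
  Convex ℝ {p : ℝ × ℝ | f p.1 ≤ (p.2 : EReal)}

/-- Convexity of `L : [0, ∞) → [-∞, ∞]`: the epigraph is convex. -/
def ConvexNNReal (L : ℝ≥0 → EReal) : Prop :=
  Convex ℝ {p : ℝ × ℝ | 0 ≤ p.1 ∧ L p.1.toNNReal ≤ (p.2 : EReal)}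

/-- The convex conjugate `f*(t) = sup_x (t x - f(x))` of `f : ℝ → [-∞, ∞]`. -/
noncomputable def conj (f : ℝ → EReal) (t : ℝ) : EReal :=
  ⨆ x : ℝ, ((t * x : ℝ) : EReal) - f x

/-- The convex conjugate `L*(t) = sup_{x ≥ 0} (t x - L(x))` of `L : [0, ∞) → [-∞, ∞]`. -/
noncomputable def conjNNReal (L : ℝ≥0 → EReal) (t : ℝ) : EReal :=
  ⨆ x : ℝ≥0, ((t * (x : ℝ) : ℝ) : EReal) - L x

/-- The extension of `L : [0, ∞) → [-∞, ∞]` to `[0, ∞]` by `L(∞) = lim_{x → ∞} L(x)`.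
The limit exists when `L` is convex; it is written as a lower limit. -/
noncomputable def extendTop (L : ℝ≥0 → EReal) (x : ℝ≥0∞) : EReal :=
  if x = ⊤ then liminf L atTop else L x.toNNReal

/-- `f'(∞) = lim_{x → ∞} f(x) / x`. The limit exists for a proper convex function; it is written
as a lower limit. -/
noncomputable def slopeTop (f : ℝ → EReal) : EReal :=
  liminf (fun x : ℝ => f x / (x : EReal)) atTop

/-- The standing assumptions on the function `φ : ℝ → ℝ ∪ {+∞}` that generates the divergence:
convex, lower semicontinuous, `φ(1) = 0`, finite on a neighbourhood of `1`, and normalized so that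
`φ = +∞` on the negative reals and `0 ∈ ∂φ(1)`, that is, `φ ≥ 0 = φ(1)`. -/
structure IsDivergenceGenerator (φ : ℝ → EReal) : Prop where
  convex : ConvexEReal φ
  lsc : LowerSemicontinuous φ
  map_one : φ 1 = 0
  finite_near_one : ∀ᶠ x in 𝓝 (1 : ℝ), φ x ≠ ⊤
  nonneg : ∀ x, 0 ≤ φ x
  top_of_neg : ∀ x < 0, φ x = ⊤

/-- `ψ*`, where `ψ(x) = φ(x + 1)`. -/
noncomputable def psiConj (φ : ℝ → EReal) : ℝ → EReal :=
  conj (fun x => φ (x + 1))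

variable {Ω : Type*} [MeasurableSpace Ω]

/-! ### Divergences and integral probability metrics -/

/-- The `φ`-divergence `D_φ(μ ‖ ν) = ν(φ(dμ_c/dν)) + μ_s(Ω) φ'(∞)` of nonnegative measures, where
`μ = μ_c + μ_s` is the Lebesgue decomposition of `μ` with respect to `ν`. It is used for `φ ≥ 0`
only, so both terms lie in `[0, ∞]`; as usual `0 * ∞ = 0`. -/
noncomputable def phiDiv (φ : ℝ → EReal) (μ ν : Measure Ω) : ℝ≥0∞ :=
  ∫⁻ ω, (φ (μ.rnDeriv ν ω).toReal).toENNReal ∂ν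
    + μ.singularPart ν univ * (slopeTop φ).toENNReal

open Classical in
/-- `IPM_G(μ, ν) = sup_{g ∈ G} |μ(g) - ν(g)|`, and `+∞` if some `g ∈ G` fails to be `μ`- or
`ν`-integrable. -/
noncomputable def ipm (G : Set (Ω → ℝ)) (μ ν : Measure Ω) : ℝ≥0∞ :=
  ⨆ g ∈ G, if Integrable g μ ∧ Integrable g ν
    then ENNReal.ofReal |∫ ω, g ω ∂μ - ∫ ω, g ω ∂ν| else ⊤

/-- The optimal lower bound function of the class `G` over `ν ∈ N`, `μ ∈ M`:
for `ε ≥ 0` the infimum of `D_φ(μ ‖ ν)` over the pairs with `sup_{g ∈ G} (μ(g) - ν(g)) = ε`,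
for `ε < 0` the infimum over the pairs with `inf_{g ∈ G} (μ(g) - ν(g)) = ε`. -/
noncomputable def lowerBound (φ : ℝ → EReal) (G : Set (Ω → ℝ))
    (N M : Set (ProbabilityMeasure Ω)) (ε : ℝ) : EReal :=
  if 0 ≤ ε then
    ⨅ (ν ∈ N) (μ ∈ M)
      (_ : (⨆ g ∈ G, ((∫ ω, g ω ∂(μ : Measure Ω) - ∫ ω, g ω ∂(ν : Measure Ω) : ℝ) : EReal)) = ε),
      (phiDiv φ (μ : Measure Ω) (ν : Measure Ω) : EReal)
  else
    ⨅ (ν ∈ N) (μ ∈ M)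
      (_ : (⨅ g ∈ G, ((∫ ω, g ω ∂(μ : Measure Ω) - ∫ ω, g ω ∂(ν : Measure Ω) : ℝ) : EReal)) = ε),
      (phiDiv φ (μ : Measure Ω) (ν : Measure Ω) : EReal)

/-! ### Sigma-ideals and essential suprema -/

/-- A `σ`-ideal of measurable sets. -/
structure SigmaIdeal (Ω : Type*) [MeasurableSpace Ω] where
  carrier : Set (Set Ω)
  measurableSet' : ∀ A ∈ carrier, MeasurableSet A
  empty_mem' : ∅ ∈ carrier
  subset_mem' : ∀ A ∈ carrier, ∀ B, MeasurableSet B → B ⊆ A → B ∈ carrier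
  iUnion_mem' : ∀ A : ℕ → Set Ω, (∀ n, A n ∈ carrier) → (⋃ n, A n) ∈ carrier

/-- The `σ`-ideal of measurable `ν`-null sets. -/
def nullIdeal (ν : Measure Ω) : SigmaIdeal Ω where
  carrier := {A | MeasurableSet A ∧ ν A = 0}
  measurableSet' _ hA := hA.1
  empty_mem' := ⟨MeasurableSet.empty, measure_empty⟩
  subset_mem' _ hA _ hB hBA := ⟨hB, measure_mono_null hBA hA.2⟩
  iUnion_mem' _ hA := ⟨MeasurableSet.iUnion fun n => (hA n).1,
    measure_iUnion_null fun n => (hA n).2⟩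

/-- The `σ`-ideal `Ξ` of the measurable sets that are null for all the signed measures in `X`. -/
def nullIdealOf (X : Submodule ℝ (SignedMeasure Ω)) : SigmaIdeal Ω where
  carrier := {A | MeasurableSet A ∧ ∀ μ ∈ X, μ.variation A = 0}
  measurableSet' _ hA := hA.1
  empty_mem' := ⟨MeasurableSet.empty, fun _ _ => measure_empty⟩
  subset_mem' _ hA _ hB hBA := ⟨hB, fun μ hμ => measure_mono_null hBA (hA.2 μ hμ)⟩
  iUnion_mem' _ hA := ⟨MeasurableSet.iUnion fun n => (hA n).1,
    fun μ hμ => measure_iUnion_null fun n => (hA n).2 μ hμ⟩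

/-- The essential range of `f` with respect to the `σ`-ideal `I`. -/
def essRange (I : SigmaIdeal Ω) (f : Ω → ℝ) : Set ℝ :=
  {x | ∀ ε > 0, f ⁻¹' Ioo (x - ε) (x + ε) ∉ I.carrier}

/-- The essential supremum of `f` with respect to `I`: the supremum of the essential range. -/
noncomputable def essSupIdeal (I : SigmaIdeal Ω) (f : Ω → ℝ) : EReal :=
  ⨆ x ∈ essRange I f, (x : EReal)

/-! ### Cumulant generating functions -/

/-- The `(φ, ν, I)`-cumulant generating function
`K_{g,ν,I}(t) = inf {ν(ψ*(t g + l)) : l ∈ ℝ, l + esssup_I (t g) ≤ φ'(∞)}`.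
(For a generator `φ` the function `ψ*` is nonnegative, so the integral is a Lebesgue integral with
values in `[0, ∞]`.) -/
noncomputable def cgfIdeal (φ : ℝ → EReal) (I : SigmaIdeal Ω) (g : Ω → ℝ) (ν : Measure Ω)
    (t : ℝ) : EReal :=
  ⨅ (l : ℝ) (_ : (l : EReal) + essSupIdeal I (fun ω => t * g ω) ≤ slopeTop φ),
    ((∫⁻ ω, (psiConj φ (t * g ω + l)).toENNReal ∂ν : ℝ≥0∞) : EReal)

/-- The `(φ, ν)`-cumulant generating function `K_{g,ν}`, where the `σ`-ideal is that of the
`ν`-null sets. -/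
noncomputable def cgf (φ : ℝ → EReal) (g : Ω → ℝ) (ν : Measure Ω) (t : ℝ) : EReal :=
  cgfIdeal φ (nullIdeal ν) g ν t

/-- `K_{G,N}(t) = sup {K_{g,ν}(t) : g ∈ G, ν ∈ N}`. -/
noncomputable def cgfSup (φ : ℝ → EReal) (G : Set (Ω → ℝ)) (N : Set (ProbabilityMeasure Ω))
    (t : ℝ) : EReal :=
  ⨆ g ∈ G, ⨆ ν ∈ N, cgf φ g (ν : Measure Ω) t

/-! ### Dual pairs of measures and functions -/

/-- `X¹`, the set of the probability measures in `X`. -/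
def probIn (X : Submodule ℝ (SignedMeasure Ω)) : Set (ProbabilityMeasure Ω) :=
  {μ | (μ : Measure Ω).toSignedMeasure ∈ X}

/-- The integral puts a vector space `X` of finite signed measures and a vector space `Y` of
measurable functions, taken modulo equality outside of a set in `Ξ`, in separating duality. Here
`Y ⊆ L⁰(Ξ)` is given by the set of the functions whose classes belong to it. -/
structure IsDualPair (X : Submodule ℝ (SignedMeasure Ω)) (Y : Submodule ℝ (Ω → ℝ)) : Prop where
  measurable : ∀ h ∈ Y, Measurable h
  integrable : ∀ μ ∈ X, ∀ h ∈ Y, Integrable h μ.variation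
  separating_left : ∀ μ ∈ X, μ ≠ 0 →
    ∃ h ∈ Y, VectorMeasure.integral μ h (ContinuousLinearMap.lsmul ℝ ℝ).flip ≠ 0
  separating_right : ∀ h ∈ Y, {ω | h ω ≠ 0} ∉ (nullIdealOf X).carrier →
    ∃ μ ∈ X, VectorMeasure.integral μ h (ContinuousLinearMap.lsmul ℝ ℝ).flip ≠ 0

/-- The pair `(X, Y)` is `ν`-decomposable, for a finite nonnegative measure `ν` in `X`. -/
structure IsDecomposable (X : Submodule ℝ (SignedMeasure Ω)) (Y : Submodule ℝ (Ω → ℝ))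
    (ν : Measure Ω) [IsFiniteMeasure ν] : Prop where
  mem : ν.toSignedMeasure ∈ X
  dualPair : IsDualPair X Y
  /-- `X` contains all the measures with an essentially bounded density with respect to `ν`. -/
  bounded_density_mem : ∀ f : Ω → ℝ, MemLp f ∞ ν → ν.withDensityᵥ f ∈ X
  /-- `L^∞(Ξ) ⊆ Y`. -/
  essBounded_mem : ∀ h : Ω → ℝ, Measurable h →
    Bornology.IsBounded (essRange (nullIdealOf X) h) → h ∈ Y
  /-- Every measurable set outside of `Ξ` carries a nonzero nonnegative measure of `X`. -/
  exists_concentrated : ∀ A : Set Ω, MeasurableSet A → A ∉ (nullIdealOf X).carrier →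
    ∃ μ ∈ X, 0 ≤ μ ∧ μ ≠ 0 ∧ μ Aᶜ = 0

/-! ### Bounds valid for all pairs of probability measures -/

/-- The probability measures that vanish on the `σ`-ideal `S` and integrate all the functions
in `G`. -/
def probIntegrating (S : SigmaIdeal Ω) (G : Set (Ω → ℝ)) : Set (ProbabilityMeasure Ω) :=
  {μ | (∀ A ∈ S.carrier, (μ : Measure Ω) A = 0) ∧ ∀ g ∈ G, Integrable g (μ : Measure Ω)}

/-- `D_φ(μ ‖ ν) ≥ L(IPM_G(μ, ν))` for all `μ, ν` in `P`. -/
def IPMBound (φ : ℝ → EReal) (P : Set (ProbabilityMeasure Ω)) (G : Set (Ω → ℝ))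
    (L : ℝ≥0 → EReal) : Prop :=
  ∀ μ ∈ P, ∀ ν ∈ P, extendTop L (ipm G (μ : Measure Ω) (ν : Measure Ω))
    ≤ (phiDiv φ (μ : Measure Ω) (ν : Measure Ω) : EReal)

/-- `D_φ(μ ‖ ν) ≥ L(|μ(g) - ν(g)|)` for all `g ∈ G` and all `μ, ν` in `P`. -/
def MeanDeviationBound (φ : ℝ → EReal) (P : Set (ProbabilityMeasure Ω)) (G : Set (Ω → ℝ))
    (L : ℝ≥0 → EReal) : Prop :=
  ∀ g ∈ G, ∀ μ ∈ P, ∀ ν ∈ P,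
    L (Real.nnabs (∫ ω, g ω ∂(μ : Measure Ω) - ∫ ω, g ω ∂(ν : Measure Ω)))
      ≤ (phiDiv φ (μ : Measure Ω) (ν : Measure Ω) : EReal)

/-- `K_{g,ν}(t) ≤ L*(|t|)` for all `t ∈ ℝ`, `g ∈ G` and `ν` in `P`. -/
def CgfBound (φ : ℝ → EReal) (P : Set (ProbabilityMeasure Ω)) (G : Set (Ω → ℝ))
    (L : ℝ≥0 → EReal) : Prop :=
  ∀ t : ℝ, ∀ g ∈ G, ∀ ν ∈ P, cgf φ g (ν : Measure Ω) t ≤ conjNNReal L |t|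

end OptimalIPM

open OptimalIPM

/-! Everything rests on one identity (`cgfSup_le_iff`). Let `N` be a set of probability measures
stable under mixtures and under bounded densities. Then, for fixed t, the supremum of K_{g,ν}(t)
over g ∈ G, ν ∈ N equals the supremum of t(μ(g) - ν(g)) - D(μ‖ν) over g ∈ G and μ, ν ∈ N.

To bound K by the dual objective (`cgf_le_of_forall_density`), fix ν and maximise ∫ (tg(f - 1) -
φ(f)) dν over bounded densities f of mass 1. As a function of the prescribed mass the optimal value
is concave, and finiteness of φ near 1 allows masses on both sides of 1, so a Lagrange multiplier l
removes the constraint. The free supremum reaches ∫ ψ*(tg + l) dν (`lintegral_psiConj_le`). The side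
condition on l in K costs nothing, since ψ*(y) < ∞ forces y ≤ φ'(∞).

Conversely, Fenchel–Young gives weak duality (`mul_mean_sub_le`), provided tg + l ≤ φ'(∞) also holds
where μ is singular. K_{g,ν} only controls ν-almost every point, so ν is replaced by (1-s)ν + sμ,
which dominates μ, and s → 0 (`mul_mean_sub_phiDiv_le_of_cgf_le`).

The conjugate formulas follow because the conjugate of an infimum is a supremum. The IPM and
single-function bounds are equivalent: mixing μ into ν scales all mean differences by s and D by at
most s, and lower semicontinuity carries a bound to the supremum. Passing from the K bound back to L
is Fenchel biconjugation on the half-line with slopes t ≥ 0 only, which is why L must be monotone or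
satisfy L(0) ≤ 0. For Pinsker, x²/2 is its own conjugate. -/

namespace OptimalIPM

/-! ### The generator and its shifted conjugate -/

namespace IsDivergenceGenerator

variable {φ : ℝ → EReal}

lemma combo_le (hφ : IsDivergenceGenerator φ) {x y r s a b : ℝ} (hx : φ x ≤ r) (hy : φ y ≤ s)
    (ha : 0 ≤ a) (hb : 0 ≤ b) (hab : a + b = 1) :
    φ (a * x + b * y) ≤ ((a * r + b * s : ℝ) : EReal) :=
  hφ.convex (x := (x, r)) hx (y := (y, s)) hy ha hb hab

lemma arg_nonneg (hφ : IsDivergenceGenerator φ) {x : ℝ} (hx : φ x ≠ ⊤) : 0 ≤ x := by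
  by_contra! h
  exact hx (hφ.top_of_neg x h)

lemma coe_toReal (hφ : IsDivergenceGenerator φ) {x : ℝ} (hx : φ x ≠ ⊤) :
    ((φ x).toReal : EReal) = φ x :=
  EReal.coe_toReal hx (ne_bot_of_le_ne_bot (by simp) (hφ.nonneg x))

lemma measurable (hφ : IsDivergenceGenerator φ) : Measurable φ := hφ.lsc.measurable

/-- Convexity on the segment from 1, where φ vanishes; the pointwise source of the contraction of D
under mixing. -/
lemma toENNReal_mix_le (hφ : IsDivergenceGenerator φ) (x : ℝ) {s : ℝ} (hs : 0 < s) (hs1 : s ≤ 1) :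
    (φ ((1 - s) * 1 + s * x)).toENNReal ≤ ENNReal.ofReal s * (φ x).toENNReal := by
  by_cases hx : φ x = ⊤
  · simp [hx, ENNReal.mul_top, hs]
  have h := hφ.combo_le (a := 1 - s) (b := s) (r := 0) (s := (φ x).toReal) (x := 1) (y := x)
    (by simp [hφ.map_one]) (hφ.coe_toReal hx).ge (by linarith) hs.le (by ring)
  have h0 : 0 ≤ (φ x).toReal := EReal.toReal_nonneg (hφ.nonneg x)
  calc (φ ((1 - s) * 1 + s * x)).toENNReal
      ≤ (((1 - s) * 0 + s * (φ x).toReal : ℝ) : EReal).toENNReal := EReal.toENNReal_le_toENNReal h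
    _ = ENNReal.ofReal s * (φ x).toENNReal := by
        rw [mul_zero, zero_add, EReal.toENNReal_of_ne_top (EReal.coe_ne_top _), EReal.toReal_coe,
          ENNReal.ofReal_mul hs.le, EReal.toENNReal_of_ne_top hx]

end IsDivergenceGenerator

/-- The Fenchel–Young inequality for `ψ*`. -/
lemma young_psiConj (φ : ℝ → EReal) (x y : ℝ) :
    ((y * (x - 1) : ℝ) : EReal) - φ x ≤ psiConj φ y := by
  have := le_iSup (fun x : ℝ => ((y * x : ℝ) : EReal) - φ (x + 1)) (x - 1)
  simpa [psiConj, conj] using this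

lemma psiConj_le_iff (φ : ℝ → EReal) (y : ℝ) (B : EReal) :
    psiConj φ y ≤ B ↔ ∀ x : ℝ, ((y * (x - 1) : ℝ) : EReal) - φ x ≤ B := by
  refine ⟨fun h x => (young_psiConj φ x y).trans h, fun h => iSup_le fun x => ?_⟩
  simpa using h (x + 1)

lemma psiConj_nonneg {φ : ℝ → EReal} (hφ : IsDivergenceGenerator φ) (y : ℝ) :
    0 ≤ psiConj φ y := by
  simpa [hφ.map_one] using young_psiConj φ 1 y

/-- `ψ*` is the supremum of countably many affine functions, indexed by points of the graph
of `φ`. -/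
lemma exists_seq_psiConj_eq {φ : ℝ → EReal} (hφ : IsDivergenceGenerator φ) :
    ∃ q : ℕ → ℝ × ℝ, (∀ n, φ (q n).1 = ((q n).2 : EReal)) ∧
      ∀ y, psiConj φ y = ⨆ n, ((y * ((q n).1 - 1) - (q n).2 : ℝ) : EReal) := by
  -- For fixed y the affine value is continuous on the graph of φ, a separable subset of the plane,
  -- so a dense sequence of graph points suffices without any continuity of φ.
  let Γ := {p : ℝ × ℝ // φ p.1 = (p.2 : EReal)}
  have : Nonempty Γ := ⟨⟨(1, 0), by simp [hφ.map_one]⟩⟩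
  refine ⟨fun n => (TopologicalSpace.denseSeq Γ n).1, fun n => (TopologicalSpace.denseSeq Γ n).2,
    fun y => le_antisymm ?_ ?_⟩
  · rw [psiConj_le_iff]
    intro x
    by_cases hx : φ x = ⊤
    · simp [hx]
    have hcont : Continuous fun p : Γ => ((y * (p.1.1 - 1) - p.1.2 : ℝ) : EReal) :=
      continuous_coe_real_ereal.comp (by fun_prop)
    have hcl := (isClosed_Iic (a := ⨆ n, ((y * ((TopologicalSpace.denseSeq Γ n).1.1 - 1)
      - (TopologicalSpace.denseSeq Γ n).1.2 : ℝ) : EReal))).preimage hcont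
    have := (TopologicalSpace.denseRange_denseSeq Γ).induction_on
      (p := fun p : Γ => ((y * (p.1.1 - 1) - p.1.2 : ℝ) : EReal) ≤
        ⨆ n, ((y * ((TopologicalSpace.denseSeq Γ n).1.1 - 1)
          - (TopologicalSpace.denseSeq Γ n).1.2 : ℝ) : EReal))
      ⟨(x, (φ x).toReal), (hφ.coe_toReal hx).symm⟩ hcl (fun n => le_iSup (fun n =>
        ((y * ((TopologicalSpace.denseSeq Γ n).1.1 - 1)
          - (TopologicalSpace.denseSeq Γ n).1.2 : ℝ) : EReal)) n)
    rw [← hφ.coe_toReal hx]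
    simpa using this
  · refine iSup_le fun n => ?_
    have := young_psiConj φ (TopologicalSpace.denseSeq Γ n).1.1 y
    rw [(TopologicalSpace.denseSeq Γ n).2] at this
    simpa using this

lemma measurable_psiConj {φ : ℝ → EReal} (hφ : IsDivergenceGenerator φ) :
    Measurable (psiConj φ) := by
  obtain ⟨q, -, hq⟩ := exists_seq_psiConj_eq hφ
  rw [funext hq]
  exact .iSup fun n => measurable_coe_real_ereal.comp (by fun_prop)

lemma slopeTop_nonneg {φ : ℝ → EReal} (hφ : IsDivergenceGenerator φ) : 0 ≤ slopeTop φ := by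
  refine le_liminf_of_le (by isBoundedDefault) ?_
  filter_upwards [eventually_ge_atTop 0] with x hx
  exact EReal.div_nonneg (hφ.nonneg x) (by exact_mod_cast hx)

/-- If φ(x) ≤ zx for arbitrarily large x and z < y, then y(x - 1) - φ(x) ≥ (y - z)x - y is
unbounded. Hence finiteness of ∫ ψ*(tg + l) already enforces the side condition on l. -/
lemma le_slopeTop_of_psiConj_ne_top {φ : ℝ → EReal} {y : ℝ}
    (hy : psiConj φ y ≠ ⊤) : (y : EReal) ≤ slopeTop φ := by
  by_contra! h
  apply hy
  obtain ⟨z, hz, hzy⟩ := EReal.lt_iff_exists_real_btwn.1 h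
  have hzy' : z < y := by exact_mod_cast hzy
  have hfreq := frequently_lt_of_liminf_lt (by isBoundedDefault) hz
  rw [EReal.eq_top_iff_forall_lt]
  intro c
  -- The threshold is the solution of (y - z)x - y = c.
  obtain ⟨x, hx, hx1⟩ := (hfreq.and_eventually
    ((eventually_gt_atTop 0).and (eventually_gt_atTop ((c + y) / (y - z))))).exists
  have hx0 : (0 : EReal) < x := by exact_mod_cast hx1.1
  have hφx : φ x ≤ ((z * x : ℝ) : EReal) := by
    have := (EReal.div_le_iff_le_mul hx0 (EReal.coe_ne_top _)).1 hx.le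
    rw [mul_comm] at this
    exact_mod_cast this
  refine lt_of_lt_of_le ?_ (young_psiConj φ x y)
  have h1 : ((y * (x - 1) : ℝ) : EReal) - ((z * x : ℝ) : EReal) ≤ (y * (x - 1) : ℝ) - φ x :=
    EReal.sub_le_sub le_rfl hφx
  refine lt_of_lt_of_le ?_ h1
  have h2 := (div_lt_iff₀ (sub_pos.2 hzy')).1 hx1.2
  rw [← EReal.coe_sub, EReal.coe_lt_coe_iff]
  linarith

lemma essSupIdeal_nullIdeal_le {Ω : Type*} [MeasurableSpace Ω] {ν : Measure Ω} {g : Ω → ℝ}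
    (hg : Measurable g) {c : ℝ} (h : ∀ᵐ ω ∂ν, g ω ≤ c) : essSupIdeal (nullIdeal ν) g ≤ c := by
  refine iSup₂_le fun x hx => ?_
  rw [EReal.coe_le_coe_iff]
  by_contra! hc
  refine hx (x - c) (by linarith) ⟨hg measurableSet_Ioo, ?_⟩
  refine measure_mono_null ?_ h
  intro ω hω
  simp only [mem_preimage, mem_Ioo, sub_sub_cancel] at hω
  simpa using hω.1

/-- The constraint in the definition of the cumulant generating function is implied by finiteness
of the integral. -/
lemma cgf_le {φ : ℝ → EReal} (hφ : IsDivergenceGenerator φ) {Ω : Type*} [MeasurableSpace Ω]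
    (ν : Measure Ω) {g : Ω → ℝ} (hg : Measurable g) (t l : ℝ) :
    cgf φ g ν t ≤ ((∫⁻ ω, (psiConj φ (t * g ω + l)).toENNReal ∂ν : ℝ≥0∞) : EReal) := by
  by_cases htop : ∫⁻ ω, (psiConj φ (t * g ω + l)).toENNReal ∂ν = ⊤
  · simp [htop]
  refine iInf₂_le l ?_
  have hmeas : Measurable fun ω => (psiConj φ (t * g ω + l)).toENNReal :=
    ((measurable_psiConj hφ).comp ((hg.const_mul t).add_const l)).ereal_toENNReal
  have hae : ∀ᵐ ω ∂ν, ((t * g ω + l : ℝ) : EReal) ≤ slopeTop φ := by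
    filter_upwards [ae_lt_top hmeas htop] with ω hω
    exact le_slopeTop_of_psiConj_ne_top fun h => by simp [h] at hω
  induction hs : slopeTop φ with
  | bot => exact absurd (slopeTop_nonneg hφ) (by simp [hs])
  | top => exact le_top
  | coe c =>
    have := essSupIdeal_nullIdeal_le (hg.const_mul t) (ν := ν) (c := c - l) (by
      filter_upwards [hae] with ω hω
      rw [hs, EReal.coe_le_coe_iff] at hω
      linarith)
    calc (l : EReal) + essSupIdeal (nullIdeal ν) (fun ω => t * g ω) ≤ l + ((c - l : ℝ) : EReal) := by
          gcongr
      _ = c := by rw [← EReal.coe_add]; congr 1; ring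

/-! ### Weak duality -/

variable {Ω : Type*} [MeasurableSpace Ω]

/-- Dropping the negative part only increases the integral, so Young's inequality may be integrated
in [0, ∞], where D and ∫ ψ* live. -/
lemma coe_integral_le_of_lintegral_le {μ : Measure Ω} {k : Ω → ℝ} {A : ℝ≥0∞} (hk : Integrable k μ)
    (h : ∫⁻ ω, ENNReal.ofReal (k ω) ∂μ ≤ A) : ((∫ ω, k ω ∂μ : ℝ) : EReal) ≤ A := by
  by_cases hA : A = ⊤
  · simp [hA]
  rw [← ENNReal.ofReal_toReal hA, EReal.coe_ennreal_ofReal, EReal.coe_le_coe_iff]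
  refine le_max_of_le_left ?_
  rw [integral_eq_lintegral_pos_part_sub_lintegral_neg_part hk]
  have := ENNReal.toReal_mono hA h
  linarith [ENNReal.toReal_nonneg (a := ∫⁻ ω, ENNReal.ofReal (-k ω) ∂μ)]

lemma ofReal_mul_sub_one_le {φ : ℝ → EReal} (hφ : IsDivergenceGenerator φ) (x y : ℝ) :
    ENNReal.ofReal (y * (x - 1)) ≤ (φ x).toENNReal + (psiConj φ y).toENNReal := by
  by_cases hx : φ x = ⊤
  · simp [hx]
  by_cases hy : psiConj φ y = ⊤
  · simp [hy]
  have h := young_psiConj φ x y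
  have hy' : ((psiConj φ y).toReal : EReal) = psiConj φ y :=
    EReal.coe_toReal hy (ne_bot_of_le_ne_bot (by simp) (psiConj_nonneg hφ y))
  rw [← hφ.coe_toReal hx, ← hy', ← EReal.coe_sub, EReal.coe_le_coe_iff] at h
  rw [EReal.toENNReal_of_ne_top hx, EReal.toENNReal_of_ne_top hy,
    ← ENNReal.ofReal_add (EReal.toReal_nonneg (hφ.nonneg x))
      (EReal.toReal_nonneg (psiConj_nonneg hφ y))]
  exact ENNReal.ofReal_le_ofReal (by linarith)

/-- Weak duality between the divergence and the cumulant generating function. -/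
lemma mul_mean_sub_le {φ : ℝ → EReal} (hφ : IsDivergenceGenerator φ) (μ ν : Measure Ω)
    [IsProbabilityMeasure μ] [IsProbabilityMeasure ν] {g : Ω → ℝ}
    (hμ : Integrable g μ) (hν : Integrable g ν) (t l : ℝ)
    (hle : ∀ᵐ ω ∂μ, ((t * g ω + l : ℝ) : EReal) ≤ slopeTop φ) :
    ((t * (∫ ω, g ω ∂μ - ∫ ω, g ω ∂ν) : ℝ) : EReal) ≤
      ((phiDiv φ μ ν + ∫⁻ ω, (psiConj φ (t * g ω + l)).toENNReal ∂ν : ℝ≥0∞) : EReal) := by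
  set u : Ω → ℝ := fun ω => t * g ω + l with hu
  have huμ : Integrable u μ := (hμ.const_mul t).add (integrable_const l)
  have huν : Integrable u ν := (hν.const_mul t).add (integrable_const l)
  have hdec : μ.singularPart ν + ν.withDensity (μ.rnDeriv ν) = μ :=
    (μ.haveLebesgueDecomposition_add ν).symm
  have hus : Integrable u (μ.singularPart ν) := huμ.mono_measure (μ.singularPart_le ν)
  have huc : Integrable u (ν.withDensity (μ.rnDeriv ν)) :=
    huμ.mono_measure (μ.withDensity_rnDeriv_le ν)
  have hfin : ∀ᵐ ω ∂ν, μ.rnDeriv ν ω < ⊤ := μ.rnDeriv_lt_top ν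
  have hufν : Integrable (fun ω => (μ.rnDeriv ν ω).toReal * u ω) ν := by
    simpa using (integrable_withDensity_iff_integrable_smul' (μ.measurable_rnDeriv ν) hfin).1 huc
  have hsplit : ∫ ω, u ω ∂μ = ∫ ω, u ω ∂(μ.singularPart ν)
      + ∫ ω, (μ.rnDeriv ν ω).toReal * u ω ∂ν := by
    conv_lhs => rw [← hdec]
    rw [integral_add_measure hus huc,
      integral_withDensity_eq_integral_toReal_smul (μ.measurable_rnDeriv ν) hfin]
    rfl
  -- The shift l cancels because μ and ν have the same mass; the rest is the Lebesgue decomposition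
  -- of μ applied to u.
  have hmean : t * (∫ ω, g ω ∂μ - ∫ ω, g ω ∂ν) = ∫ ω, u ω ∂(μ.singularPart ν)
      + ∫ ω, u ω * ((μ.rnDeriv ν ω).toReal - 1) ∂ν := by
    have h1 : ∫ ω, u ω ∂μ = t * ∫ ω, g ω ∂μ + l := by
      rw [hu, integral_add (hμ.const_mul t) (integrable_const l), integral_const_mul]; simp
    have h2 : ∫ ω, u ω ∂ν = t * ∫ ω, g ω ∂ν + l := by
      rw [hu, integral_add (hν.const_mul t) (integrable_const l), integral_const_mul]; simp
    have h3 : ∫ ω, u ω * ((μ.rnDeriv ν ω).toReal - 1) ∂ν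
        = ∫ ω, (μ.rnDeriv ν ω).toReal * u ω ∂ν - ∫ ω, u ω ∂ν := by
      rw [← integral_sub hufν huν]
      congr 1; ext ω; ring
    rw [h3]; linarith
  have hS : ((∫ ω, u ω ∂(μ.singularPart ν) : ℝ) : EReal) ≤
      ((μ.singularPart ν univ * (slopeTop φ).toENNReal : ℝ≥0∞) : EReal) := by
    refine coe_integral_le_of_lintegral_le hus ?_
    calc ∫⁻ ω, ENNReal.ofReal (u ω) ∂(μ.singularPart ν)
        ≤ ∫⁻ _, (slopeTop φ).toENNReal ∂(μ.singularPart ν) := by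
          refine lintegral_mono_ae ?_
          filter_upwards [(Measure.absolutelyContinuous_of_le (μ.singularPart_le ν)).ae_le hle]
            with ω hω
          have := EReal.toENNReal_le_toENNReal hω
          rwa [EReal.toENNReal_of_ne_top (EReal.coe_ne_top _), EReal.toReal_coe] at this
      _ = μ.singularPart ν univ * (slopeTop φ).toENNReal := by
          rw [lintegral_const, mul_comm]
  have hC : ((∫ ω, u ω * ((μ.rnDeriv ν ω).toReal - 1) ∂ν : ℝ) : EReal) ≤
      ((∫⁻ ω, (φ (μ.rnDeriv ν ω).toReal).toENNReal ∂ν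
        + ∫⁻ ω, (psiConj φ (u ω)).toENNReal ∂ν : ℝ≥0∞) : EReal) := by
    refine coe_integral_le_of_lintegral_le ?_ ?_
    · refine (hufν.sub huν).congr (ae_of_all _ fun ω => ?_)
      simp only [Pi.sub_apply]; ring
    · have hm : Measurable fun ω => (φ (μ.rnDeriv ν ω).toReal).toENNReal :=
        (hφ.measurable.comp (μ.measurable_rnDeriv ν).ennreal_toReal).ereal_toENNReal
      rw [← lintegral_add_left hm]
      exact lintegral_mono fun ω => ofReal_mul_sub_one_le hφ _ _
  rw [hmean, EReal.coe_add]
  refine (add_le_add hS hC).trans_eq ?_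
  rw [← EReal.coe_ennreal_add, phiDiv]
  congr 1
  ring

/-! ### Removing the singular part by mixing -/

/-- A set of probability measures is closed under mixtures. -/
def IsMixClosed (N : Set (ProbabilityMeasure Ω)) : Prop :=
  ∀ μ ∈ N, ∀ ν ∈ N, ∀ s : ℝ, 0 < s → s < 1 → ∀ η : ProbabilityMeasure Ω,
    (η : Measure Ω) = ENNReal.ofReal (1 - s) • (ν : Measure Ω) + ENNReal.ofReal s • (μ : Measure Ω)
    → η ∈ N

lemma exists_mix (μ ν : ProbabilityMeasure Ω) {s : ℝ} (hs : 0 < s) (hs1 : s < 1) :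
    ∃ η : ProbabilityMeasure Ω, (η : Measure Ω) =
      ENNReal.ofReal (1 - s) • (ν : Measure Ω) + ENNReal.ofReal s • (μ : Measure Ω) := by
  refine ⟨⟨_, ⟨?_⟩⟩, rfl⟩
  simp only [Measure.coe_add, Measure.coe_smul, Pi.add_apply, Pi.smul_apply, measure_univ,
    smul_eq_mul, mul_one]
  rw [← ENNReal.ofReal_add (by linarith) hs.le]
  simp

lemma coe_le_of_forall_mul_le {c : ℝ} {B : EReal}
    (h : ∀ s : ℝ, 0 < s → s < 1 → (((1 - s) * c : ℝ) : EReal) ≤ B) : (c : EReal) ≤ B := by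
  have hlim : Tendsto (fun s : ℝ => (((1 - s) * c : ℝ) : EReal)) (𝓝[>] 0) (𝓝 (c : EReal)) := by
    have : Continuous fun s : ℝ => (((1 - s) * c : ℝ) : EReal) :=
      continuous_coe_real_ereal.comp (by fun_prop)
    simpa using (this.tendsto 0).mono_left nhdsWithin_le_nhds
  refine le_of_tendsto hlim ?_
  filter_upwards [Ioo_mem_nhdsGT (zero_lt_one (α := ℝ))] with s hs using h s hs.1 hs.2

/-- An upper bound for the cumulant generating functions of all `ν ∈ N` yields a lower bound of
the divergence on `N`. The singular part is dealt with by mixing `μ` into `ν`. -/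
lemma mul_mean_sub_phiDiv_le_of_cgf_le {φ : ℝ → EReal} (hφ : IsDivergenceGenerator φ)
    {N : Set (ProbabilityMeasure Ω)} (hN : IsMixClosed N) {g : Ω → ℝ} (hg : Measurable g)
    (hint : ∀ ν ∈ N, Integrable g (ν : Measure Ω)) {t : ℝ} {B : EReal}
    (hB : ∀ ν ∈ N, cgf φ g (ν : Measure Ω) t ≤ B) {μ ν : ProbabilityMeasure Ω}
    (hμ : μ ∈ N) (hν : ν ∈ N) :
    ((t * (∫ ω, g ω ∂(μ : Measure Ω) - ∫ ω, g ω ∂(ν : Measure Ω)) : ℝ) : EReal)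
      - (phiDiv φ (μ : Measure Ω) (ν : Measure Ω) : EReal) ≤ B := by
  set m : ℝ := t * (∫ ω, g ω ∂(μ : Measure Ω) - ∫ ω, g ω ∂(ν : Measure Ω))
  by_cases hD : phiDiv φ (μ : Measure Ω) (ν : Measure Ω) = ⊤
  · simp [hD]
  have hDr : ((phiDiv φ (μ : Measure Ω) (ν : Measure Ω) : ℝ≥0∞) : EReal)
      = ((phiDiv φ (μ : Measure Ω) (ν : Measure Ω)).toReal : ℝ) :=
    (EReal.coe_ennreal_toReal hD).symm
  rw [hDr, ← EReal.coe_sub]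
  refine coe_le_of_forall_mul_le fun s hs hs1 => ?_
  obtain ⟨η, hη⟩ := exists_mix μ ν hs hs1
  refine le_trans ?_ (hB η (hN μ hμ ν hν s hs hs1 η hη))
  refine le_iInf₂ fun l _ => ?_
  by_cases htop : ∫⁻ ω, (psiConj φ (t * g ω + l)).toENNReal ∂(η : Measure Ω) = ⊤
  · simp [htop]
  have hmeas : Measurable fun ω => (psiConj φ (t * g ω + l)).toENNReal :=
    ((measurable_psiConj hφ).comp ((hg.const_mul t).add_const l)).ereal_toENNReal
  -- The bound holds η-almost everywhere by finiteness; since μ ≪ η it holds μ-almost everywhere, as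
  -- weak duality for the original pair (μ, ν) requires.
  have hae : ∀ᵐ ω ∂(η : Measure Ω), ((t * g ω + l : ℝ) : EReal) ≤ slopeTop φ := by
    filter_upwards [ae_lt_top hmeas htop] with ω hω
    exact le_slopeTop_of_psiConj_ne_top fun h => by simp [h] at hω
  have hac : (μ : Measure Ω) ≪ (η : Measure Ω) := by
    refine Measure.AbsolutelyContinuous.mk fun A _ hA => ?_
    rw [hη] at hA
    simp only [Measure.coe_add, Measure.coe_smul, Pi.add_apply, Pi.smul_apply, smul_eq_mul,
      add_eq_zero, mul_eq_zero, ENNReal.ofReal_eq_zero] at hA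
    exact hA.2.resolve_left (by linarith)
  have hweak := mul_mean_sub_le hφ (μ : Measure Ω) (ν : Measure Ω) (hint μ hμ) (hint ν hν) t l
    (hac.ae_le hae)
  set I := ∫⁻ ω, (psiConj φ (t * g ω + l)).toENNReal ∂(ν : Measure Ω)
  -- Only ψ* ≥ 0 is needed: the μ-share of the integral against η is discarded.
  have hI : ENNReal.ofReal (1 - s) * I
      ≤ ∫⁻ ω, (psiConj φ (t * g ω + l)).toENNReal ∂(η : Measure Ω) := by
    rw [hη, lintegral_add_measure, lintegral_smul_measure]
    exact le_self_add
  refine le_trans ?_ (EReal.coe_ennreal_le_coe_ennreal_iff.2 hI)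
  by_cases hItop : I = ⊤
  · rw [hItop, ENNReal.mul_top (by simpa using hs1)]; simp
  rw [← EReal.coe_ennreal_toReal (ENNReal.add_ne_top.2 ⟨hD, hItop⟩), ENNReal.toReal_add hD hItop,
    EReal.coe_le_coe_iff] at hweak
  rw [← ENNReal.ofReal_toReal hItop, ← ENNReal.ofReal_mul (by linarith), EReal.coe_ennreal_ofReal,
    EReal.coe_le_coe_iff]
  refine le_max_of_le_left (mul_le_mul_of_nonneg_left ?_ (by linarith))
  linarith

/-! ### Strong duality -/

/-- Existence of a supergradient at `0` of the concave function on the line whose hypograph is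
generated by `C`. -/
lemma exists_supergradient {C : Set (ℝ × ℝ)} {V : ℝ} (hneg : ∃ p ∈ C, p.1 < 0)
    (hpos : ∃ p ∈ C, 0 < p.1) (h0 : ∀ p ∈ C, p.1 = 0 → p.2 ≤ V)
    (hC : ∀ p ∈ C, ∀ p' ∈ C, p.1 < 0 → 0 < p'.1 → p'.1 * p.2 - p.1 * p'.2 ≤ (p'.1 - p.1) * V) :
    ∃ l : ℝ, ∀ p ∈ C, p.2 + l * p.1 ≤ V := by
  -- Points with negative first coordinate bound l from below, those with positive first coordinate
  -- from above. `hC` says that every lower bound is at most every upper bound, so the supremum of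
  -- the lower bounds serves as l.
  let S : Set ℝ := (fun p : ℝ × ℝ => (p.2 - V) / (-p.1)) '' {p ∈ C | p.1 < 0}
  have hub : ∀ p' ∈ C, 0 < p'.1 → (V - p'.2) / p'.1 ∈ upperBounds S := by
    rintro p' hp' hp'0 _ ⟨p, ⟨hp, hp0⟩, rfl⟩
    simp only
    rw [div_le_div_iff₀ (by linarith) hp'0]
    linarith [hC p hp p' hp' hp0 hp'0]
  obtain ⟨p₁, hp₁, hp₁0⟩ := hneg
  obtain ⟨p₂, hp₂, hp₂0⟩ := hpos
  have hS : S.Nonempty := ⟨_, p₁, ⟨hp₁, hp₁0⟩, rfl⟩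
  have hbdd : BddAbove S := ⟨_, hub p₂ hp₂ hp₂0⟩
  refine ⟨sSup S, fun p hp => ?_⟩
  rcases lt_trichotomy p.1 0 with h | h | h
  · have : (p.2 - V) / (-p.1) ≤ sSup S := le_csSup hbdd ⟨p, ⟨hp, h⟩, rfl⟩
    rw [div_le_iff₀ (by linarith)] at this
    linarith
  · simpa [h] using h0 p hp h
  · have : sSup S ≤ (V - p.2) / p.1 := csSup_le hS (hub p hp h)
    rw [le_div_iff₀ h] at this
    linarith

/-- The densities used in the proof of strong duality: `f` and `φ ∘ f` are bounded. -/
def IsBoundedDensity (φ : ℝ → EReal) (f : Ω → ℝ) : Prop :=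
  Measurable f ∧ ∃ M : ℝ, ∀ ω, f ω ≤ M ∧ φ (f ω) ≤ (M : EReal)

namespace IsBoundedDensity

variable {φ : ℝ → EReal} {f f' : Ω → ℝ}

lemma ne_top (hf : IsBoundedDensity φ f) (ω : Ω) : φ (f ω) ≠ ⊤ := by
  obtain ⟨-, M, hM⟩ := hf
  exact ne_top_of_le_ne_top (EReal.coe_ne_top _) (hM ω).2

lemma nonneg (hφ : IsDivergenceGenerator φ) (hf : IsBoundedDensity φ f) (ω : Ω) : 0 ≤ f ω :=
  hφ.arg_nonneg (hf.ne_top ω)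

lemma const {c : ℝ} (hc : φ c ≠ ⊤) : IsBoundedDensity φ (fun _ : Ω => c) := by
  refine ⟨measurable_const, max c (φ c).toReal, fun _ => ⟨le_max_left _ _, ?_⟩⟩
  exact (EReal.le_coe_toReal hc).trans (by exact_mod_cast le_max_right _ _)

lemma combo (hφ : IsDivergenceGenerator φ) (hf : IsBoundedDensity φ f)
    (hf' : IsBoundedDensity φ f') {a b : ℝ} (ha : 0 ≤ a) (hb : 0 ≤ b) (hab : a + b = 1) :
    IsBoundedDensity φ (fun ω => a * f ω + b * f' ω) := by
  obtain ⟨hm, M, hM⟩ := hf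
  obtain ⟨hm', M', hM'⟩ := hf'
  refine ⟨(hm.const_mul a).add (hm'.const_mul b), a * M + b * M', fun ω => ⟨?_, ?_⟩⟩
  · exact add_le_add (mul_le_mul_of_nonneg_left (hM ω).1 ha)
      (mul_le_mul_of_nonneg_left (hM' ω).1 hb)
  · exact hφ.combo_le (hM ω).2 (hM' ω).2 ha hb hab

lemma piecewise (hf : IsBoundedDensity φ f) (hf' : IsBoundedDensity φ f') {A : Set Ω}
    (hA : MeasurableSet A) [DecidablePred (· ∈ A)] : IsBoundedDensity φ (A.piecewise f f') := by
  obtain ⟨hm, M, hM⟩ := hf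
  obtain ⟨hm', M', hM'⟩ := hf'
  refine ⟨hm.piecewise hA hm', max M M', fun ω => ?_⟩
  by_cases hω : ω ∈ A
  · simp only [hω, piecewise_eq_of_mem]
    exact ⟨(hM ω).1.trans (le_max_left _ _),
      (hM ω).2.trans (by exact_mod_cast le_max_left _ _)⟩
  · simp only [hω, not_false_eq_true, piecewise_eq_of_notMem]
    exact ⟨(hM' ω).1.trans (le_max_right _ _),
      (hM' ω).2.trans (by exact_mod_cast le_max_right _ _)⟩

lemma bound (hφ : IsDivergenceGenerator φ) (hf : IsBoundedDensity φ f) :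
    ∃ M : ℝ, (∀ ω, ‖f ω‖ ≤ M) ∧ ∀ ω, ‖(φ (f ω)).toReal‖ ≤ M := by
  obtain ⟨M, hM⟩ := hf.2
  refine ⟨M, fun ω => ?_, fun ω => ?_⟩
  · rw [Real.norm_of_nonneg (hf.nonneg hφ ω)]; exact (hM ω).1
  · rw [Real.norm_of_nonneg (EReal.toReal_nonneg (hφ.nonneg _))]
    have := (hM ω).2
    rwa [← hφ.coe_toReal (hf.ne_top ω), EReal.coe_le_coe_iff] at this

lemma measurable_toReal (hφ : IsDivergenceGenerator φ) (hf : IsBoundedDensity φ f) :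
    Measurable fun ω => (φ (f ω)).toReal :=
  (hφ.measurable.comp hf.1).ereal_toReal

lemma integrable (hφ : IsDivergenceGenerator φ) (hf : IsBoundedDensity φ f) (ν : Measure Ω)
    [IsFiniteMeasure ν] : Integrable f ν := by
  obtain ⟨M, hM, -⟩ := hf.bound hφ
  exact .of_bound hf.1.aestronglyMeasurable M (ae_of_all _ hM)

lemma integrable_toReal (hφ : IsDivergenceGenerator φ) (hf : IsBoundedDensity φ f) (ν : Measure Ω)
    [IsFiniteMeasure ν] : Integrable (fun ω => (φ (f ω)).toReal) ν := by
  obtain ⟨M, -, hM⟩ := hf.bound hφ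
  exact .of_bound (hf.measurable_toReal hφ).aestronglyMeasurable M (ae_of_all _ hM)

lemma integrable_mul (hφ : IsDivergenceGenerator φ) (hf : IsBoundedDensity φ f) {ν : Measure Ω}
    [IsFiniteMeasure ν] {u : Ω → ℝ} (hu : Integrable u ν) :
    Integrable (fun ω => u ω * f ω) ν := by
  obtain ⟨M, hM, -⟩ := hf.bound hφ
  exact hu.mul_bdd hf.1.aestronglyMeasurable (ae_of_all _ hM)

lemma integrable_value (hφ : IsDivergenceGenerator φ) (hf : IsBoundedDensity φ f) {ν : Measure Ω}
    [IsFiniteMeasure ν] {u : Ω → ℝ} (hu : Integrable u ν) :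
    Integrable (fun ω => u ω * (f ω - 1) - (φ (f ω)).toReal) ν := by
  refine (((hf.integrable_mul hφ hu).sub hu).sub (hf.integrable_toReal hφ ν)).congr
    (ae_of_all _ fun ω => ?_)
  simp only [Pi.sub_apply]; ring

end IsBoundedDensity

/-- Interchange of the integral and the supremum in the conjugate. -/
lemma lintegral_psiConj_le {φ : ℝ → EReal} (hφ : IsDivergenceGenerator φ) {ν : Measure Ω}
    [IsFiniteMeasure ν] {u : Ω → ℝ} (hum : Measurable u) (hu : Integrable u ν) {V : ℝ}
    (hV : ∀ f, IsBoundedDensity φ f → ∫ ω, (u ω * (f ω - 1) - (φ (f ω)).toReal) ∂ν ≤ V) :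
    ∫⁻ ω, (psiConj φ (u ω)).toENNReal ∂ν ≤ ENNReal.ofReal V := by
  classical
  obtain ⟨q, hq, hqs⟩ := exists_seq_psiConj_eq hφ
  let v : (Ω → ℝ) → Ω → ℝ := fun f ω => u ω * (f ω - 1) - (φ (f ω)).toReal
  let a : ℕ → Ω → ℝ := fun n ω => u ω * ((q n).1 - 1) - (q n).2
  have hqt : ∀ n, φ (q n).1 ≠ ⊤ := fun n => by simp [hq n]
  have ha : ∀ n, a n = v fun _ => (q n).1 := fun n => by ext ω; simp [a, v, hq n]
  have hvm : ∀ f, IsBoundedDensity φ f → Measurable (v f) := fun f hf =>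
    (hum.mul (hf.1.sub_const 1)).sub (hf.measurable_toReal hφ)
  -- Greedy choice: switch to the constant density `(q n).1` exactly where it improves the
  -- integrand. Starting from the density 1, of value 0, the values are nonnegative and increase to
  -- ψ*(u), so monotone convergence applies.
  let F : ℕ → Ω → ℝ := fun n => Nat.rec (fun _ => 1)
    (fun n f => {ω | v f ω < a n ω}.piecewise (fun _ => (q n).1) f) n
  have hF : ∀ n, IsBoundedDensity φ (F n) := by
    intro n
    induction n with
    | zero => exact IsBoundedDensity.const (by simp [hφ.map_one])
    | succ n ih =>
      refine (IsBoundedDensity.const (hqt n)).piecewise ih ?_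
      rw [ha]
      exact measurableSet_lt (hvm _ ih) (hvm _ (IsBoundedDensity.const (hqt n)))
  have hvF : ∀ n ω, v (F (n + 1)) ω = max (v (F n) ω) (a n ω) := by
    intro n ω
    have hsucc : F (n + 1) = {ω | v (F n) ω < a n ω}.piecewise (fun _ => (q n).1) (F n) := rfl
    by_cases hω : v (F n) ω < a n ω
    · rw [max_eq_right hω.le, ha]
      simp only [v, hsucc]
      rw [piecewise_eq_of_mem _ _ _ (by exact hω)]
    · rw [max_eq_left (not_lt.1 hω)]
      simp only [v, hsucc]
      rw [piecewise_eq_of_notMem _ _ _ (by exact hω)]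
  have hmono : ∀ ω, Monotone fun n => v (F n) ω := fun ω =>
    monotone_nat_of_le_succ fun n => by rw [hvF]; exact le_max_left _ _
  have hv0 : ∀ n ω, 0 ≤ v (F n) ω := fun n ω => by
    have : v (F 0) ω = 0 := by simp [v, F, hφ.map_one]
    rw [← this]; exact hmono ω (Nat.zero_le n)
  have hle : ∀ ω, (psiConj φ (u ω)).toENNReal ≤ ⨆ n, ENNReal.ofReal (v (F n) ω) := by
    intro ω
    rw [← EReal.coe_ennreal_le_coe_ennreal_iff, EReal.coe_toENNReal (psiConj_nonneg hφ _), hqs]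
    refine iSup_le fun n => ?_
    refine le_trans ?_ (EReal.coe_ennreal_le_coe_ennreal_iff.2
      (le_iSup (fun n => ENNReal.ofReal (v (F n) ω)) (n + 1)))
    rw [EReal.coe_ennreal_ofReal, EReal.coe_le_coe_iff]
    refine le_max_of_le_left ?_
    rw [hvF]
    exact le_max_right _ _
  refine (lintegral_mono hle).trans ?_
  rw [lintegral_iSup (fun n => (hvm _ (hF n)).ennreal_ofReal)
    (fun m n hmn ω => ENNReal.ofReal_le_ofReal (hmono ω hmn))]
  refine iSup_le fun n => ?_
  rw [← ofReal_integral_eq_lintegral_ofReal ((hF n).integrable_value hφ hu)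
    (ae_of_all _ (hv0 n))]
  exact ENNReal.ofReal_le_ofReal (hV _ (hF n))

/-- Strong duality: the cumulant generating function is bounded by the supremum of the dual
objective over the probability densities. -/
lemma cgf_le_of_forall_density {φ : ℝ → EReal} (hφ : IsDivergenceGenerator φ) {ν : Measure Ω}
    [IsProbabilityMeasure ν] {g : Ω → ℝ} (hgm : Measurable g) (hg : Integrable g ν) {t : ℝ}
    {B : EReal}
    (hB : ∀ f, IsBoundedDensity φ f → ∫ ω, f ω ∂ν = 1 →
      ((∫ ω, (t * g ω * (f ω - 1) - (φ (f ω)).toReal) ∂ν : ℝ) : EReal) ≤ B) :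
    cgf φ g ν t ≤ B := by
  induction B with
  | top => exact le_top
  | bot =>
    have := hB (fun _ => 1) (IsBoundedDensity.const (by simp [hφ.map_one])) (by simp)
    simp at this
  | coe V =>
  have htg : Integrable (fun ω => t * g ω) ν := hg.const_mul t
  let w : (Ω → ℝ) → ℝ := fun f => ∫ ω, (t * g ω * (f ω - 1) - (φ (f ω)).toReal) ∂ν
  have hwV : ∀ f, IsBoundedDensity φ f → ∫ ω, f ω ∂ν = 1 → w f ≤ V := fun f hf h1 =>
    EReal.coe_le_coe_iff.1 (hB f hf h1)
  have hV0 : 0 ≤ V := by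
    simpa [w, hφ.map_one] using
      hwV (fun _ => 1) (IsBoundedDensity.const (by simp [hφ.map_one])) (by simp)
  obtain ⟨ε, hε, hfin⟩ := Metric.eventually_nhds_iff.1 hφ.finite_near_one
  -- Pairs of mass defect and objective value; a supergradient at defect 0 is the Lagrange
  -- multiplier for the mass constraint.
  let C : Set (ℝ × ℝ) := {p | ∃ f, IsBoundedDensity φ f ∧ p = (∫ ω, f ω ∂ν - 1, w f)}
  have hconst : ∀ c : ℝ, dist c 1 < ε → ∃ p ∈ C, p.1 = c - 1 := fun c hc =>
    ⟨_, ⟨fun _ => c, IsBoundedDensity.const (hfin hc), rfl⟩, by simp⟩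
  obtain ⟨l, hl⟩ : ∃ l : ℝ, ∀ p ∈ C, p.2 + l * p.1 ≤ V := by
    refine exists_supergradient ?_ ?_ ?_ ?_
    · obtain ⟨p, hp, hp1⟩ := hconst (1 - ε / 2) (by
        rw [Real.dist_eq, abs_of_nonpos (by linarith)]; linarith)
      exact ⟨p, hp, by linarith⟩
    · obtain ⟨p, hp, hp1⟩ := hconst (1 + ε / 2) (by
        rw [Real.dist_eq, abs_of_nonneg (by linarith)]; linarith)
      exact ⟨p, hp, by linarith⟩
    · rintro _ ⟨f, hf, rfl⟩ h0
      exact hwV f hf (by simpa [sub_eq_zero] using h0)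
    · rintro _ ⟨f, hf, rfl⟩ _ ⟨f', hf', rfl⟩ hs hs'
      simp only at hs hs' ⊢
      set s := ∫ ω, f ω ∂ν - 1 with hsdef
      set s' := ∫ ω, f' ω ∂ν - 1 with hsdef'
      have hd : 0 < s' - s := by linarith
      -- The weights solve a + b = 1 and as + bs' = 0, so that the mixed density has mass 1 and the
      -- bound V applies to it.
      set a := s' / (s' - s) with had
      set b := -s / (s' - s) with hbd
      have ha : 0 ≤ a := div_nonneg hs'.le hd.le
      have hb : 0 ≤ b := div_nonneg (by linarith) hd.le
      have hab : a + b = 1 := by rw [had, hbd]; field_simp; ring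
      have hcomb := hf.combo hφ hf' ha hb hab
      have hi := hf.integrable hφ ν
      have hi' := hf'.integrable hφ ν
      have hint : ∫ ω, (a * f ω + b * f' ω) ∂ν = 1 := by
        rw [integral_add (hi.const_mul a) (hi'.const_mul b), integral_const_mul,
          integral_const_mul]
        have e1 : ∫ ω, f ω ∂ν = s + 1 := by rw [hsdef]; ring
        have e2 : ∫ ω, f' ω ∂ν = s' + 1 := by rw [hsdef']; ring
        rw [e1, e2, had, hbd]; field_simp; ring
      have hle : a * w f + b * w f' ≤ V := by
        refine le_trans ?_ (hwV _ hcomb hint)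
        rw [← integral_const_mul, ← integral_const_mul,
          ← integral_add ((hf.integrable_value hφ htg).const_mul a)
            ((hf'.integrable_value hφ htg).const_mul b)]
        refine integral_mono (((hf.integrable_value hφ htg).const_mul a).add
          ((hf'.integrable_value hφ htg).const_mul b)) (hcomb.integrable_value hφ htg)
          fun ω => ?_
        have hc := hφ.combo_le (hφ.coe_toReal (hf.ne_top ω)).ge (hφ.coe_toReal (hf'.ne_top ω)).ge
          ha hb hab
        rw [← hφ.coe_toReal (hcomb.ne_top ω), EReal.coe_le_coe_iff] at hc
        have hb' : b = 1 - a := by linarith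
        have : t * g ω * (a * f ω + b * f' ω - 1)
            = a * (t * g ω * (f ω - 1)) + b * (t * g ω * (f' ω - 1)) := by rw [hb']; ring
        rw [this]
        linarith
      have key : (s' - s) * (a * w f + b * w f') = s' * w f - s * w f' := by
        rw [had, hbd]; field_simp; ring
      rw [← key]
      exact mul_le_mul_of_nonneg_left hle hd.le
  refine (cgf_le hφ ν hgm t l).trans ?_
  have hu : Integrable (fun ω => t * g ω + l) ν := htg.add (integrable_const l)
  have := lintegral_psiConj_le hφ ((hgm.const_mul t).add_const l) hu (V := V) fun f hf => by
    have h1 := hl _ ⟨f, hf, rfl⟩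
    refine le_trans (le_of_eq ?_) h1
    have hi : Integrable (fun ω => f ω - 1) ν := (hf.integrable hφ ν).sub (integrable_const 1)
    have e : ∫ ω, (f ω - 1) ∂ν = ∫ ω, f ω ∂ν - 1 := by
      rw [integral_sub (hf.integrable hφ ν) (integrable_const 1)]; simp
    simp only [w]
    rw [← e, ← integral_const_mul, ← integral_add (hf.integrable_value hφ htg) (hi.const_mul l)]
    congr 1; ext ω; ring
  refine (EReal.coe_ennreal_le_coe_ennreal_iff.2 this).trans ?_
  rw [EReal.coe_ennreal_ofReal, max_eq_left hV0]

/-- A set of probability measures is closed under passing to a bounded density. -/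
def IsDensityClosed (N : Set (ProbabilityMeasure Ω)) : Prop :=
  ∀ ν ∈ N, ∀ f : Ω → ℝ, Measurable f → (∀ ω, 0 ≤ f ω) → (∃ M, ∀ ω, f ω ≤ M) →
    ∀ μ : ProbabilityMeasure Ω,
      (μ : Measure Ω) = (ν : Measure Ω).withDensity (fun ω => ENNReal.ofReal (f ω)) → μ ∈ N

lemma phiDiv_withDensity {φ : ℝ → EReal} (hφ : IsDivergenceGenerator φ) {ν : Measure Ω}
    [IsFiniteMeasure ν] {f : Ω → ℝ} (hf : IsBoundedDensity φ f) :
    phiDiv φ (ν.withDensity fun ω => ENNReal.ofReal (f ω)) ν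
      = ENNReal.ofReal (∫ ω, (φ (f ω)).toReal ∂ν) := by
  rw [phiDiv, (Measure.singularPart_eq_zero _ _).2 (withDensity_absolutelyContinuous _ _),
    ofReal_integral_eq_lintegral_ofReal (hf.integrable_toReal hφ ν)
      (ae_of_all _ fun ω => EReal.toReal_nonneg (hφ.nonneg _))]
  simp only [Measure.coe_zero, Pi.zero_apply, zero_mul, add_zero]
  refine lintegral_congr_ae ?_
  filter_upwards [Measure.rnDeriv_withDensity ν hf.1.ennreal_ofReal] with ω hω
  rw [hω, ENNReal.toReal_ofReal (hf.nonneg hφ ω), EReal.toENNReal_of_ne_top (hf.ne_top ω)]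

/-- The cumulant generating function is bounded by the supremum of the dual objective over
`μ ∈ N`. -/
lemma cgf_le_of_mul_mean_sub_phiDiv_le {φ : ℝ → EReal} (hφ : IsDivergenceGenerator φ)
    {N : Set (ProbabilityMeasure Ω)} (hN : IsDensityClosed N) {g : Ω → ℝ} (hgm : Measurable g)
    {ν : ProbabilityMeasure Ω} (hν : ν ∈ N) (hg : Integrable g (ν : Measure Ω))
    {t : ℝ} {B : EReal}
    (hB : ∀ μ ∈ N,
      ((t * (∫ ω, g ω ∂(μ : Measure Ω) - ∫ ω, g ω ∂(ν : Measure Ω)) : ℝ) : EReal)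
        - (phiDiv φ (μ : Measure Ω) (ν : Measure Ω) : EReal) ≤ B) :
    cgf φ g (ν : Measure Ω) t ≤ B := by
  refine cgf_le_of_forall_density hφ hgm hg fun f hf h1 => ?_
  have hf0 := hf.nonneg hφ
  let μ : ProbabilityMeasure Ω :=
    ⟨(ν : Measure Ω).withDensity fun ω => ENNReal.ofReal (f ω), ⟨by
      rw [withDensity_apply _ MeasurableSet.univ, Measure.restrict_univ,
        ← ofReal_integral_eq_lintegral_ofReal (hf.integrable hφ _) (ae_of_all _ hf0), h1,
        ENNReal.ofReal_one]⟩⟩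
  obtain ⟨M, hM⟩ := hf.2
  have hμN : μ ∈ N := hN ν hν f hf.1 hf0 ⟨M, fun ω => (hM ω).1⟩ μ rfl
  refine le_trans (le_of_eq ?_) (hB μ hμN)
  have hgμ : ∫ ω, g ω ∂(μ : Measure Ω) = ∫ ω, g ω * f ω ∂(ν : Measure Ω) := by
    change ∫ ω, g ω ∂((ν : Measure Ω).withDensity fun ω => ENNReal.ofReal (f ω)) = _
    rw [integral_withDensity_eq_integral_toReal_smul hf.1.ennreal_ofReal
      (ae_of_all _ fun ω => ENNReal.ofReal_lt_top)]
    refine integral_congr_ae (ae_of_all _ fun ω => ?_)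
    simp only [ENNReal.toReal_ofReal (hf0 ω), smul_eq_mul, mul_comm]
  have hD : phiDiv φ (μ : Measure Ω) (ν : Measure Ω)
      = ENNReal.ofReal (∫ ω, (φ (f ω)).toReal ∂(ν : Measure Ω)) := phiDiv_withDensity hφ hf
  have hgf : Integrable (fun ω => g ω * f ω - g ω) (ν : Measure Ω) :=
    (hf.integrable_mul hφ hg).sub hg
  rw [hD, EReal.coe_ennreal_ofReal,
    max_eq_left (integral_nonneg fun ω => EReal.toReal_nonneg (hφ.nonneg _)), ← EReal.coe_sub,
    hgμ, ← integral_sub (hf.integrable_mul hφ hg) hg, ← integral_const_mul,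
    ← integral_sub (hgf.const_mul t) (hf.integrable_toReal hφ _)]
  congr 2
  ext ω
  ring

/-! ### Divergence and means along mixtures -/

lemma phiDiv_self {φ : ℝ → EReal} (hφ : IsDivergenceGenerator φ) (ν : Measure Ω)
    [IsFiniteMeasure ν] : phiDiv φ ν ν = 0 := by
  rw [phiDiv, Measure.singularPart_self]
  simp only [Measure.coe_zero, Pi.zero_apply, zero_mul, add_zero]
  rw [lintegral_congr_ae (g := fun _ => 0), lintegral_zero]
  filter_upwards [ν.rnDeriv_self] with ω hω
  simp [hω, hφ.map_one]

/-- Convexity of the divergence in its first argument, along the segment from `ν` to `μ`. -/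
lemma phiDiv_mix_le {φ : ℝ → EReal} (hφ : IsDivergenceGenerator φ) (μ ν : Measure Ω)
    [IsFiniteMeasure μ] [IsFiniteMeasure ν] {s : ℝ} (hs : 0 < s) (hs1 : s < 1) :
    phiDiv φ (ENNReal.ofReal (1 - s) • ν + ENNReal.ofReal s • μ) ν
      ≤ ENNReal.ofReal s * phiDiv φ μ ν := by
  have hsing : (ENNReal.ofReal (1 - s) • ν + ENNReal.ofReal s • μ).singularPart ν
      = ENNReal.ofReal s • μ.singularPart ν := by
    change ((1 - s).toNNReal • ν + s.toNNReal • μ).singularPart ν = s.toNNReal • μ.singularPart ν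
    rw [Measure.singularPart_add, Measure.singularPart_smul, Measure.singularPart_smul,
      Measure.singularPart_self, smul_zero, zero_add]
  have hrn : (ENNReal.ofReal (1 - s) • ν + ENNReal.ofReal s • μ).rnDeriv ν =ᵐ[ν]
      fun ω => ENNReal.ofReal (1 - s) + ENNReal.ofReal s * μ.rnDeriv ν ω := by
    have h1 : IsFiniteMeasure (ENNReal.ofReal (1 - s) • ν) :=
      inferInstanceAs (IsFiniteMeasure ((1 - s).toNNReal • ν))
    have h2 : IsFiniteMeasure (ENNReal.ofReal s • μ) :=
      inferInstanceAs (IsFiniteMeasure (s.toNNReal • μ))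
    filter_upwards [Measure.rnDeriv_add (ENNReal.ofReal (1 - s) • ν) (ENNReal.ofReal s • μ) ν,
      Measure.rnDeriv_smul_left_of_ne_top ν ν (ENNReal.ofReal_ne_top (r := 1 - s)),
      Measure.rnDeriv_smul_left_of_ne_top μ ν (ENNReal.ofReal_ne_top (r := s)),
      ν.rnDeriv_self] with ω e1 e2 e3 e4
    rw [e1, Pi.add_apply, e2, e3, Pi.smul_apply, Pi.smul_apply, e4]
    simp
  rw [phiDiv, phiDiv, hsing, mul_add, ← lintegral_const_mul' _ _ ENNReal.ofReal_ne_top,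
    Measure.smul_apply, smul_eq_mul, mul_assoc]
  gcongr ?_ + _
  refine lintegral_mono_ae ?_
  filter_upwards [hrn, μ.rnDeriv_lt_top ν] with ω hω htop
  rw [hω, ENNReal.toReal_add ENNReal.ofReal_ne_top
    (ENNReal.mul_ne_top ENNReal.ofReal_ne_top htop.ne), ENNReal.toReal_mul,
    ENNReal.toReal_ofReal (by linarith), ENNReal.toReal_ofReal hs.le]
  simpa using hφ.toENNReal_mix_le (μ.rnDeriv ν ω).toReal hs hs1.le

lemma integral_mix_sub {μ ν η : ProbabilityMeasure Ω} {s : ℝ} (hs : 0 < s) (hs1 : s < 1)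
    (hη : (η : Measure Ω) = ENNReal.ofReal (1 - s) • (ν : Measure Ω)
      + ENNReal.ofReal s • (μ : Measure Ω)) {g : Ω → ℝ}
    (hμ : Integrable g (μ : Measure Ω)) (hν : Integrable g (ν : Measure Ω)) :
    ∫ ω, g ω ∂(η : Measure Ω) - ∫ ω, g ω ∂(ν : Measure Ω)
      = s * (∫ ω, g ω ∂(μ : Measure Ω) - ∫ ω, g ω ∂(ν : Measure Ω)) := by
  rw [hη, integral_add_measure (hν.smul_measure ENNReal.ofReal_ne_top)
    (hμ.smul_measure ENNReal.ofReal_ne_top), integral_smul_measure, integral_smul_measure,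
    ENNReal.toReal_ofReal (by linarith), ENNReal.toReal_ofReal hs.le]
  simp only [smul_eq_mul]
  ring

/-! ### Probability measures integrating the class -/

section probIntegrating

variable {S : SigmaIdeal Ω} {G : Set (Ω → ℝ)}

lemma isMixClosed_probIntegrating : IsMixClosed (probIntegrating S G) := by
  intro μ hμ ν hν s _ _ η hη
  refine ⟨fun A hA => ?_, fun g hg => ?_⟩
  · rw [hη]; simp [hμ.1 A hA, hν.1 A hA]
  · rw [hη]
    exact ((hν.2 g hg).smul_measure ENNReal.ofReal_ne_top).add_measure
      ((hμ.2 g hg).smul_measure ENNReal.ofReal_ne_top)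

lemma isDensityClosed_probIntegrating : IsDensityClosed (probIntegrating S G) := by
  intro ν hν f hf hf0 ⟨M, hM⟩ μ hμ
  refine ⟨fun A hA => ?_, fun g hg => ?_⟩
  · rw [hμ]
    exact withDensity_absolutelyContinuous _ _ (hν.1 A hA)
  · rw [hμ, integrable_withDensity_iff_integrable_smul' hf.ennreal_ofReal
      (ae_of_all _ fun ω => ENNReal.ofReal_lt_top)]
    refine ((hν.2 g hg).bdd_mul (f := f) (c := M) hf.aestronglyMeasurable
      (ae_of_all _ fun ω => ?_)).congr (ae_of_all _ fun ω => ?_)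
    · rw [Real.norm_of_nonneg (hf0 ω)]; exact hM ω
    · simp [ENNReal.toReal_ofReal (hf0 ω)]

lemma ipm_eq {μ ν : ProbabilityMeasure Ω} (hμ : ∀ g ∈ G, Integrable g (μ : Measure Ω))
    (hν : ∀ g ∈ G, Integrable g (ν : Measure Ω)) :
    ipm G (μ : Measure Ω) (ν : Measure Ω) =
      ⨆ g ∈ G, ((Real.nnabs (∫ ω, g ω ∂(μ : Measure Ω) - ∫ ω, g ω ∂(ν : Measure Ω)) : ℝ≥0)
        : ℝ≥0∞) := by
  refine biSup_congr fun g hg => ?_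
  rw [if_pos ⟨hμ g hg, hν g hg⟩, ENNReal.ofReal, Real.toNNReal_abs]

/-- All mean differences from ν scale by the same factor s, hence so does their supremum, also when
it is infinite. -/
lemma ipm_mix {μ ν η : ProbabilityMeasure Ω} {s : ℝ} (hs : 0 < s) (hs1 : s < 1)
    (hη : (η : Measure Ω) = ENNReal.ofReal (1 - s) • (ν : Measure Ω)
      + ENNReal.ofReal s • (μ : Measure Ω))
    (hμ : μ ∈ probIntegrating S G) (hν : ν ∈ probIntegrating S G) :
    ipm G (η : Measure Ω) (ν : Measure Ω)
      = ENNReal.ofReal s * ipm G (μ : Measure Ω) (ν : Measure Ω) := by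
  have hηP := isMixClosed_probIntegrating μ hμ ν hν s hs hs1 η hη
  rw [ipm_eq hηP.2 hν.2, ipm_eq hμ.2 hν.2]
  simp_rw [ENNReal.mul_iSup]
  refine biSup_congr fun g hg => ?_
  rw [integral_mix_sub hs hs1 hη (hμ.2 g hg) (hν.2 g hg), map_mul, ENNReal.coe_mul,
    Real.nnabs_of_nonneg hs.le]
  rfl

lemma le_ipm {μ ν : ProbabilityMeasure Ω} (hμ : μ ∈ probIntegrating S G)
    (hν : ν ∈ probIntegrating S G) {g : Ω → ℝ} (hg : g ∈ G) :
    ((Real.nnabs (∫ ω, g ω ∂(μ : Measure Ω) - ∫ ω, g ω ∂(ν : Measure Ω)) : ℝ≥0) : ℝ≥0∞)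
      ≤ ipm G (μ : Measure Ω) (ν : Measure Ω) := by
  rw [ipm_eq hμ.2 hν.2]
  exact le_iSup₂ (f := fun g _ => ((Real.nnabs (∫ ω, g ω ∂(μ : Measure Ω)
    - ∫ ω, g ω ∂(ν : Measure Ω)) : ℝ≥0) : ℝ≥0∞)) g hg

end probIntegrating

/-! ### Convex lower semicontinuous functions on the half-line -/

section lowerBoundFunctions

variable {L : ℝ≥0 → EReal}

lemma ConvexNNReal.le_of_le (hL : ConvexNNReal L) {x y : ℝ≥0} {c : ℝ} (hxy : x < y)
    (h0 : L 0 ≤ c) (hy : L y ≤ c) : L x ≤ c := by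
  have hy0 : (0 : ℝ) < y := lt_of_le_of_lt x.2 hxy
  have hx1 : (x : ℝ) / y ≤ 1 := (div_le_one hy0).2 (by exact_mod_cast hxy.le)
  have := hL (x := ((0 : ℝ), c)) ⟨le_rfl, by simpa using h0⟩ (y := ((y : ℝ), c))
    ⟨y.2, by simpa using hy⟩ (a := 1 - x / y) (b := x / y) (by linarith)
    (div_nonneg x.2 hy0.le) (by ring)
  have h2 := this.2
  simp only [Prod.smul_mk, Prod.mk_add_mk, smul_eq_mul, mul_zero, zero_add] at h2
  rw [div_mul_cancel₀ _ hy0.ne', Real.toNNReal_coe] at h2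
  convert h2 using 2
  ring

/-- Every x lies between 0 and some larger point at which L is below a given c > 0; convexity bounds
L(x) by c. -/
lemma ConvexNNReal.le_of_liminf_le (hL : ConvexNNReal L) (h0 : L 0 ≤ 0)
    (h : liminf L atTop ≤ 0) (x : ℝ≥0) : L x ≤ 0 := by
  rw [← EReal.le_of_forall_lt_iff_le]
  intro c hc
  obtain ⟨y, hy, hxy⟩ := ((frequently_lt_of_liminf_lt (by isBoundedDefault)
    (h.trans_lt hc)).and_eventually (eventually_gt_atTop x)).exists
  exact hL.le_of_le hxy (h0.trans hc.le) hy.le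

lemma extendTop_coe (x : ℝ≥0) : extendTop L x = L x := by simp [extendTop]

/-- A lower semicontinuous bound passes from a set of numbers to its supremum. -/
lemma extendTop_iSup_le (hL : LowerSemicontinuous L) {ι : Type*} {G : Set ι} (hG : G.Nonempty)
    {x : ι → ℝ≥0} {D : EReal} (h : ∀ g ∈ G, L (x g) ≤ D) :
    extendTop L (⨆ g ∈ G, (x g : ℝ≥0∞)) ≤ D := by
  have hex : ∀ a : ℝ≥0, (a : ℝ≥0∞) < ⨆ g ∈ G, (x g : ℝ≥0∞) → ∃ g ∈ G, a < x g := fun a ha => by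
    obtain ⟨g, hg, hag⟩ := lt_biSup_iff.1 ha
    exact ⟨g, hg, by exact_mod_cast hag⟩
  have hle : ∀ g ∈ G, (x g : ℝ≥0∞) ≤ ⨆ g ∈ G, (x g : ℝ≥0∞) := fun g hg =>
    le_iSup₂ (f := fun g _ => (x g : ℝ≥0∞)) g hg
  generalize (⨆ g ∈ G, (x g : ℝ≥0∞)) = b at hex hle
  induction b with
  | top =>
    rw [extendTop, if_pos rfl]
    refine liminf_le_of_frequently_le (frequently_atTop.2 fun a => ?_) (by isBoundedDefault)
    obtain ⟨g, hg, hag⟩ := hex a ENNReal.coe_lt_top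
    exact ⟨x g, hag.le, h g hg⟩
  | coe b =>
    rw [extendTop_coe]
    by_contra! hD
    -- For b > 0, lower semicontinuity keeps L above D on some (a, b], which contains a value `x g`.
    -- At b = 0 there is no room on the left, but then all the values are 0.
    rcases eq_or_ne b 0 with rfl | hb
    · obtain ⟨g, hg⟩ := hG
      have : x g = 0 := by simpa using hle g hg
      exact absurd (h g hg) (by rw [this]; exact hD.not_ge)
    · obtain ⟨a, hab, ha⟩ := exists_Ioc_subset_of_mem_nhds (hL b D hD) ⟨0, pos_iff_ne_zero.2 hb⟩
      obtain ⟨g, hg, hag⟩ := hex a (by exact_mod_cast hab)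
      exact absurd (h g hg) (not_le.2 (ha ⟨hag, by exact_mod_cast hle g hg⟩))

lemma conjNNReal_le (hbot : ∀ x, L x ≠ ⊥) {t c : ℝ}
    (h : ∀ (y : ℝ≥0) (r : ℝ), L y = r → t * y - r ≤ c) : conjNNReal L t ≤ c := by
  refine iSup_le fun y => ?_
  by_cases hy : L y = ⊤
  · simp [hy]
  have hr := EReal.coe_toReal hy (hbot y)
  rw [← hr, ← EReal.coe_sub, EReal.coe_le_coe_iff]
  exact h y _ hr.symm

/-- The relevant part of the biconjugate theorem on the half-line. -/
lemma le_of_forall_sub_le_conjNNReal (hL : ConvexNNReal L) (hlsc : LowerSemicontinuous L)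
    (hbot : ∀ x, L x ≠ ⊥) (hmono : Monotone L ∨ L 0 ≤ 0) {x : ℝ≥0} {d : ℝ} (hd : 0 ≤ d)
    (h : ∀ t : ℝ, 0 ≤ t → ((t * x - d : ℝ) : EReal) ≤ conjNNReal L t) : L x ≤ d := by
  by_contra! hlt
  obtain ⟨d', hdd', hd'⟩ := EReal.lt_iff_exists_real_btwn.1 hlt
  replace hdd' : d < d' := by exact_mod_cast hdd'
  have hconj : ∀ t c : ℝ, 0 ≤ t → (∀ (y : ℝ≥0) (r : ℝ), L y = r → t * y - r ≤ c) →
      t * x - d ≤ c := fun t c ht hc =>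
    EReal.coe_le_coe_iff.1 ((h t ht).trans (conjNNReal_le hbot hc))
  -- Otherwise L would be +∞ everywhere and its conjugate -∞, against the hypothesis at t = 0.
  obtain ⟨y₀, r₀, hy₀⟩ : ∃ (y : ℝ≥0) (r : ℝ), L y = r := by
    by_contra! hne
    linarith [hconj 0 (-d - 1) le_rfl fun y r hr => absurd hr (hne y r)]
  let E : Set (ℝ × ℝ) := {p | 0 ≤ p.1 ∧ L p.1.toNNReal ≤ (p.2 : EReal)}
  have hEc : IsClosed E := by
    refine (isClosed_le continuous_const continuous_fst).inter ?_
    exact hlsc.isClosed_epigraph.preimage (f := fun p : ℝ × ℝ => (p.1.toNNReal, (p.2 : EReal)))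
      ((continuous_real_toNNReal.comp continuous_fst).prodMk
        (continuous_coe_real_ereal.comp continuous_snd))
  have hxE : ((x : ℝ), d') ∉ E := fun hx => absurd hx.2 (by simpa using hd')
  obtain ⟨f, u, hfx, hfE⟩ := geometric_hahn_banach_point_closed hL hEc hxE
  set α := f (1, 0)
  set β := f (0, 1)
  have hf : ∀ y r : ℝ, f (y, r) = α * y + β * r := by
    intro y r
    have : ((y, r) : ℝ × ℝ) = y • ((1, 0) : ℝ × ℝ) + r • ((0, 1) : ℝ × ℝ) := by simp
    rw [this, map_add, map_smul, map_smul, smul_eq_mul, smul_eq_mul, mul_comm y, mul_comm r]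
  rw [hf] at hfx
  have hE : ∀ (y : ℝ≥0) (r : ℝ), L y ≤ r → u < α * y + β * r := fun y r hr => by
    rw [← hf]
    exact hfE _ ⟨y.2, by simpa using hr⟩
  have hβ : 0 ≤ β := by
    by_contra! hβ
    have h1 := hE y₀ r₀ hy₀.le
    have hn : 0 ≤ (α * y₀ + β * r₀ - u) / (-β) := div_nonneg (by linarith) (by linarith)
    have h2 := hE y₀ (r₀ + (α * y₀ + β * r₀ - u) / (-β))
      (by rw [hy₀, EReal.coe_le_coe_iff]; linarith)
    have h3 : β * ((α * y₀ + β * r₀ - u) / (-β)) = -(α * y₀ + β * r₀ - u) := by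
      have := hβ.ne
      field_simp
    rw [mul_add, h3] at h2
    linarith
  -- Case β = 0: the hyperplane is vertical, so x lies outside the domain of L. For α > 0 it would
  -- lie left of the domain, which either alternative in `hmono` excludes. For α < 0 the domain is
  -- contained in [0, u/α], where L is bounded below by compactness, so a steep slope t violates
  -- `h`.
  rcases hβ.eq_or_lt with hβ0 | hβ0
  · rw [← hβ0] at hfx hE
    simp only [zero_mul, add_zero] at hfx hE
    rcases lt_or_ge 0 α with hα | hα
    · rcases hmono with hm | hm
      · have hxy : x ≤ y₀ := by
          have := hfx.trans (hE y₀ r₀ hy₀.le)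
          exact_mod_cast (lt_of_mul_lt_mul_left this hα.le).le
        linarith [hE x r₀ ((hm hxy).trans hy₀.le)]
      · have := hE 0 0 (by simpa using hm)
        simp only [NNReal.coe_zero, mul_zero] at this
        linarith [mul_nonneg hα.le x.coe_nonneg]
    · have hα0 : α < 0 := by
        refine lt_of_le_of_ne hα fun h0 => ?_
        have := hE y₀ r₀ hy₀.le
        rw [h0] at hfx this
        simp only [zero_mul] at hfx this
        linarith
      have hz : ∀ (y : ℝ≥0) (r : ℝ), L y = r → (y : ℝ) ≤ u / α := fun y r hr => by
        rw [le_div_iff_of_neg hα0, mul_comm]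
        exact (hE y r hr.le).le
      have hxz : u / α < x := by
        rw [div_lt_iff_of_neg hα0, mul_comm]
        exact hfx
      obtain ⟨m, hm⟩ : ∃ m : ℝ, ∀ (y : ℝ≥0) (r : ℝ), L y = r → m ≤ r := by
        obtain ⟨y₁, -, hy₁⟩ := LowerSemicontinuousOn.exists_isMinOn
          (s := Icc (0 : ℝ≥0) (u / α).toNNReal) ⟨0, by simp⟩ isCompact_Icc
          (hlsc.lowerSemicontinuousOn _)
        obtain ⟨m, -, hm⟩ := EReal.lt_iff_exists_real_btwn.1 (bot_lt_iff_ne_bot.2 (hbot y₁))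
        refine ⟨m, fun y r hr => ?_⟩
        have hy : y ∈ Icc (0 : ℝ≥0) (u / α).toNNReal := by
          refine ⟨zero_le, ?_⟩
          rw [← Real.toNNReal_coe (r := y)]
          exact Real.toNNReal_le_toNNReal (hz y r hr)
        have := hm.le.trans (hy₁ hy)
        rwa [hr, EReal.coe_le_coe_iff] at this
      have hpos : 0 < (x : ℝ) - u / α := by linarith
      have hdm : 0 ≤ |d - m| + 1 := by positivity
      set t := (|d - m| + 1) / (x - u / α) with ht
      have ht0 : 0 ≤ t := div_nonneg hdm hpos.le
      have h1 := hconj t (t * (u / α) - m) ht0 fun y r hr => by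
        have := mul_le_mul_of_nonneg_left (hz y r hr) ht0
        linarith [hm y r hr]
      have h2 : t * (x - u / α) = |d - m| + 1 := div_mul_cancel₀ _ hpos.ne'
      linarith [le_abs_self (d - m)]
  -- Here t·y + u/β is an affine minorant of L that exceeds d' at x. Slopes t ≥ 0 contradict `h`
  -- directly. For t < 0, monotonicity gives L ≥ d' everywhere, against `h` at slope 0; and L(0) ≤ 0
  -- makes the minorant negative at x, although d' > d ≥ 0.
  · set t := -α / β with ht
    have htβ : t * β = -α := div_mul_cancel₀ _ hβ0.ne'
    have hub : u / β * β = u := div_mul_cancel₀ _ hβ0.ne'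
    have hE' : ∀ (y : ℝ≥0) (r : ℝ), L y ≤ r → t * y + u / β < r := fun y r hr => by
      refine lt_of_mul_lt_mul_right ?_ hβ0.le
      have : (t * y + u / β) * β = t * β * y + u / β * β := by ring
      rw [this, htβ, hub]
      linarith [hE y r hr]
    have hx' : d' < t * x + u / β := by
      refine lt_of_mul_lt_mul_right ?_ hβ0.le
      have : (t * x + u / β) * β = t * β * x + u / β * β := by ring
      rw [this, htβ, hub]
      linarith
    rcases le_or_gt 0 t with ht0 | ht0
    · linarith [hconj t (-(u / β)) ht0 fun y r hr => by linarith [hE' y r hr.le]]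
    · rcases hmono with hm | hm
      · have := hconj 0 (-d') le_rfl fun y r hr => by
          rcases le_total x y with hxy | hxy
          · have := hd'.le.trans ((hm hxy).trans hr.le)
            rw [EReal.coe_le_coe_iff] at this
            linarith
          · have := mul_le_mul_of_nonpos_left (NNReal.coe_le_coe.2 hxy) ht0.le
            linarith [hE' y r hr.le]
        linarith
      · have := hE' 0 0 (by simpa using hm)
        simp only [NNReal.coe_zero, mul_zero, zero_add] at this
        linarith [mul_nonpos_of_nonpos_of_nonneg ht0.le x.coe_nonneg]

end lowerBoundFunctions

/-! ### Equivalence of the three bounds -/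

section operational

variable {φ : ℝ → EReal} {S : SigmaIdeal Ω} {G : Set (Ω → ℝ)} {L : ℝ≥0 → EReal}

/-- L need not be monotone, so a bound at the IPM is moved down to a smaller mean difference by
mixing: the IPM can be scaled to the desired value while D does not increase. -/
lemma meanDeviationBound_of_ipmBound (hφ : IsDivergenceGenerator φ) (hL : ConvexNNReal L)
    (h : IPMBound φ (probIntegrating S G) G L) :
    MeanDeviationBound φ (probIntegrating S G) G L := by
  intro g hg μ hμ ν hν
  set x : ℝ≥0 := Real.nnabs (∫ ω, g ω ∂(μ : Measure Ω) - ∫ ω, g ω ∂(ν : Measure Ω))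
  have hx : (x : ℝ≥0∞) ≤ ipm G (μ : Measure Ω) (ν : Measure Ω) := le_ipm hμ hν hg
  have hself : L 0 ≤ 0 := by
    have h0 : ipm G (μ : Measure Ω) (μ : Measure Ω) = ((0 : ℝ≥0) : ℝ≥0∞) := by
      rw [ipm_eq hμ.2 hμ.2]; simp
    have := h μ hμ μ hμ
    rwa [phiDiv_self hφ, h0, extendTop_coe] at this
  have hmix : ∀ s : ℝ, 0 < s → s < 1 →
      extendTop L (ENNReal.ofReal s * ipm G (μ : Measure Ω) (ν : Measure Ω))
        ≤ ((ENNReal.ofReal s * phiDiv φ (μ : Measure Ω) (ν : Measure Ω) : ℝ≥0∞) : EReal) := by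
    intro s hs hs1
    obtain ⟨η, hη⟩ := exists_mix μ ν hs hs1
    have := h η (isMixClosed_probIntegrating μ hμ ν hν s hs hs1 η hη) ν hν
    rw [ipm_mix hs hs1 hη hμ hν] at this
    refine this.trans (EReal.coe_ennreal_le_coe_ennreal_iff.2 ?_)
    rw [hη]
    exact phiDiv_mix_le hφ _ _ hs hs1
  by_cases hD : phiDiv φ (μ : Measure Ω) (ν : Measure Ω) = ⊤
  · simp [hD]
  rcases eq_or_ne (ipm G (μ : Measure Ω) (ν : Measure Ω)) ⊤ with hb | hb
  -- An infinite IPM stays infinite under mixing while D shrinks with s, so L(∞) ≤ 0; with L(0) ≤ 0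
  -- this gives L ≤ 0.
  · refine (hL.le_of_liminf_le hself ?_ x).trans (EReal.coe_ennreal_nonneg _)
    refine ge_of_tendsto (f := fun s : ℝ =>
      ((s * (phiDiv φ (μ : Measure Ω) (ν : Measure Ω)).toReal : ℝ) : EReal)) (x := 𝓝[>] 0) ?_ ?_
    · have : Continuous fun s : ℝ =>
          ((s * (phiDiv φ (μ : Measure Ω) (ν : Measure Ω)).toReal : ℝ) : EReal) :=
        continuous_coe_real_ereal.comp (by fun_prop)
      simpa using (this.tendsto 0).mono_left nhdsWithin_le_nhds
    · filter_upwards [Ioo_mem_nhdsGT (zero_lt_one (α := ℝ))] with s hs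
      have := hmix s hs.1 hs.2
      rw [hb, ENNReal.mul_top (by simpa using hs.1), extendTop, if_pos rfl,
        ← ENNReal.ofReal_toReal hD, ← ENNReal.ofReal_mul hs.1.le, EReal.coe_ennreal_ofReal,
        max_eq_left (mul_nonneg hs.1.le ENNReal.toReal_nonneg)] at this
      exact this
  · obtain ⟨b, hb'⟩ : ∃ b : ℝ≥0, (b : ℝ≥0∞) = _ := ⟨_, ENNReal.coe_toNNReal hb⟩
    rw [← hb'] at hx hmix
    replace hx : x ≤ b := by exact_mod_cast hx
    rcases eq_or_ne x 0 with hx0 | hx0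
    · rw [hx0]
      exact hself.trans (EReal.coe_ennreal_nonneg _)
    rcases hx.eq_or_lt with hxb | hxb
    · have := h μ hμ ν hν
      rwa [← hb', extendTop_coe, ← hxb] at this
    -- Mixing with s = x/b brings the IPM from b down to exactly x.
    · have hb0 : 0 < b := lt_of_le_of_lt zero_le hxb
      have hs : (0 : ℝ) < (x / b : ℝ≥0) := by
        have := div_pos (pos_iff_ne_zero.2 hx0) hb0
        exact_mod_cast this
      have hs1 : ((x / b : ℝ≥0) : ℝ) < 1 := by
        have := (div_lt_one hb0).2 hxb
        exact_mod_cast this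
      have := hmix _ hs hs1
      rw [ENNReal.ofReal_coe_nnreal, ← ENNReal.coe_mul, div_mul_cancel₀ _ hb0.ne',
        extendTop_coe] at this
      refine this.trans (EReal.coe_ennreal_le_coe_ennreal_iff.2 ?_)
      refine mul_le_of_le_one_left zero_le ?_
      exact_mod_cast hs1.le

lemma ipmBound_of_meanDeviationBound (hG : G.Nonempty) (hlsc : LowerSemicontinuous L)
    (h : MeanDeviationBound φ (probIntegrating S G) G L) :
    IPMBound φ (probIntegrating S G) G L := by
  intro μ hμ ν hν
  rw [ipm_eq hμ.2 hν.2]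
  exact extendTop_iSup_le hlsc hG fun g hg => h g hg μ hμ ν hν

lemma cgfBound_of_meanDeviationBound (hφ : IsDivergenceGenerator φ)
    (hGm : ∀ g ∈ G, Measurable g) (h : MeanDeviationBound φ (probIntegrating S G) G L) :
    CgfBound φ (probIntegrating S G) G L := by
  intro t g hg ν hν
  refine cgf_le_of_mul_mean_sub_phiDiv_le hφ isDensityClosed_probIntegrating (hGm g hg) hν
    (hν.2 g hg) fun μ hμ => ?_
  set m := ∫ ω, g ω ∂(μ : Measure Ω) - ∫ ω, g ω ∂(ν : Measure Ω)
  refine le_trans (EReal.sub_le_sub ?_ (h g hg μ hμ ν hν))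
    (le_iSup (fun x : ℝ≥0 => ((|t| * (x : ℝ) : ℝ) : EReal) - L x) (Real.nnabs m))
  rw [EReal.coe_le_coe_iff, Real.coe_nnabs, ← abs_mul]
  exact le_abs_self _

lemma meanDeviationBound_of_cgfBound (hφ : IsDivergenceGenerator φ)
    (hGm : ∀ g ∈ G, Measurable g) (hL : ConvexNNReal L) (hlsc : LowerSemicontinuous L)
    (hbot : ∀ x, L x ≠ ⊥) (hmono : Monotone L ∨ L 0 ≤ 0)
    (h : CgfBound φ (probIntegrating S G) G L) :
    MeanDeviationBound φ (probIntegrating S G) G L := by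
  intro g hg μ hμ ν hν
  by_cases hD : phiDiv φ (μ : Measure Ω) (ν : Measure Ω) = ⊤
  · simp [hD]
  set m := ∫ ω, g ω ∂(μ : Measure Ω) - ∫ ω, g ω ∂(ν : Measure Ω) with hm
  have key : ∀ t : ℝ, ((t * m - (phiDiv φ (μ : Measure Ω) (ν : Measure Ω)).toReal : ℝ) : EReal)
      ≤ conjNNReal L |t| := fun t => by
    have := mul_mean_sub_phiDiv_le_of_cgf_le hφ isMixClosed_probIntegrating (hGm g hg)
      (fun ν hν => hν.2 g hg) (fun ν hν => h t g hg ν hν) hμ hν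
    rwa [← hm, ← EReal.coe_ennreal_toReal hD, ← EReal.coe_sub] at this
  rw [← EReal.coe_ennreal_toReal hD]
  refine le_of_forall_sub_le_conjNNReal hL hlsc hbot hmono ENNReal.toReal_nonneg fun t ht => ?_
  rw [Real.coe_nnabs]
  -- The sign of the slope is chosen to agree with that of m, which turns t·m into |t|·|m|.
  rcases le_total 0 m with hm0 | hm0
  · simpa [abs_of_nonneg hm0, abs_of_nonneg ht] using key t
  · simpa [abs_of_nonpos hm0, abs_of_nonneg ht] using key (-t)

end operational

/-! ### The quadratic bound -/

section quadratic

lemma convexNNReal_quadratic : ConvexNNReal fun x => (((x : ℝ) ^ 2 / 2 : ℝ) : EReal) := by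
  rintro ⟨x, r⟩ ⟨hx, hr⟩ ⟨y, s⟩ ⟨hy, hs⟩ a b ha hb hab
  simp only [Real.coe_toNNReal _ hx, Real.coe_toNNReal _ hy, EReal.coe_le_coe_iff] at hx hr hy hs
  have h0 : 0 ≤ a * x + b * y := add_nonneg (mul_nonneg ha hx) (mul_nonneg hb hy)
  refine ⟨h0, ?_⟩
  simp only [Prod.smul_mk, Prod.mk_add_mk, smul_eq_mul, Real.coe_toNNReal _ h0,
    EReal.coe_le_coe_iff]
  obtain rfl : b = 1 - a := by linarith
  nlinarith [mul_le_mul_of_nonneg_left hr ha, mul_le_mul_of_nonneg_left hs hb,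
    mul_nonneg (mul_nonneg ha hb) (sq_nonneg (x - y))]

lemma continuous_quadratic : Continuous fun x : ℝ≥0 => (((x : ℝ) ^ 2 / 2 : ℝ) : EReal) :=
  continuous_coe_real_ereal.comp (by fun_prop)

lemma conjNNReal_quadratic {t : ℝ} (ht : 0 ≤ t) :
    conjNNReal (fun x => (((x : ℝ) ^ 2 / 2 : ℝ) : EReal)) t = ((t ^ 2 / 2 : ℝ) : EReal) := by
  refine le_antisymm (iSup_le fun x => ?_) ?_
  · rw [← EReal.coe_sub, EReal.coe_le_coe_iff]
    nlinarith [sq_nonneg (t - x)]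
  · refine le_trans (le_of_eq ?_) (le_iSup (fun x : ℝ≥0 =>
      ((t * (x : ℝ) : ℝ) : EReal) - (((x : ℝ) ^ 2 / 2 : ℝ) : EReal)) t.toNNReal)
    simp only [Real.coe_toNNReal _ ht]
    rw [← EReal.coe_sub]
    congr 1
    ring

lemma extendTop_quadratic (x : ℝ≥0∞) :
    extendTop (fun x => (((x : ℝ) ^ 2 / 2 : ℝ) : EReal)) x = ((x ^ 2 / 2 : ℝ≥0∞) : EReal) := by
  induction x with
  | top =>
    rw [extendTop, if_pos rfl]
    have : Tendsto (fun x : ℝ≥0 => (((x : ℝ) ^ 2 / 2 : ℝ) : EReal)) atTop (𝓝 ⊤) := by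
      refine EReal.tendsto_coe_nhds_top_iff.2 ?_
      refine Tendsto.atTop_div_const (by norm_num) ?_
      exact (tendsto_pow_atTop two_ne_zero).comp (NNReal.tendsto_coe_atTop.2 tendsto_id)
    rw [this.liminf_eq]
    simp [ENNReal.top_div]
  | coe x =>
    rw [extendTop_coe]
    have : ((x : ℝ≥0∞) ^ 2 / 2) = ((x ^ 2 / 2 : ℝ≥0) : ℝ≥0∞) := by
      rw [ENNReal.coe_div two_ne_zero]; simp
    rw [this]
    rfl

end quadratic

/-! ### Conjugates of the optimal lower bounds -/

section conjugate

/-- Finiteness of a lets x and B trade places even at infinite values. It turns a bound on the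
conjugate of an infimum into bounds on the individual divergences. -/
lemma coe_sub_le_comm {a : ℝ} {x B : EReal} : (a : EReal) - x ≤ B ↔ (a : EReal) - B ≤ x := by
  induction x with
  | bot => induction B <;> simp [← EReal.coe_sub]
  | top => simp
  | coe x =>
    induction B with
    | bot => simp [← EReal.coe_sub]
    | top => simp
    | coe b =>
      rw [← EReal.coe_sub, ← EReal.coe_sub, EReal.coe_le_coe_iff, EReal.coe_le_coe_iff]
      exact sub_le_comm

variable {φ : ℝ → EReal} {N : Set (ProbabilityMeasure Ω)} {G : Set (Ω → ℝ)}

/-- The values of `cgfSup` are suprema of the dual objective over `g ∈ G` and `μ, ν ∈ N`. -/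
lemma cgfSup_le_iff (hφ : IsDivergenceGenerator φ) (hmix : IsMixClosed N)
    (hden : IsDensityClosed N) (hGm : ∀ g ∈ G, Measurable g)
    (hint : ∀ g ∈ G, ∀ ν ∈ N, Integrable g (ν : Measure Ω)) {t : ℝ} {B : EReal} :
    cgfSup φ G N t ≤ B ↔ ∀ g ∈ G, ∀ μ ∈ N, ∀ ν ∈ N,
      ((t * (∫ ω, g ω ∂(μ : Measure Ω) - ∫ ω, g ω ∂(ν : Measure Ω)) : ℝ) : EReal)
        - (phiDiv φ (μ : Measure Ω) (ν : Measure Ω) : EReal) ≤ B := by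
  refine ⟨fun h g hg μ hμ ν hν => ?_, fun h => ?_⟩
  · refine mul_mean_sub_phiDiv_le_of_cgf_le hφ hmix (hGm g hg) (hint g hg) (fun ν hν => ?_) hμ hν
    exact (le_iSup₂ (f := fun (ν : ProbabilityMeasure Ω) (_ : ν ∈ N) =>
      cgf φ g (ν : Measure Ω) t) ν hν).trans
      ((le_iSup₂ (f := fun g (_ : g ∈ G) => ⨆ ν ∈ N, cgf φ g (ν : Measure Ω) t) g hg).trans h)
  · refine iSup₂_le fun g hg => iSup₂_le fun ν hν => ?_
    exact cgf_le_of_mul_mean_sub_phiDiv_le hφ hden (hGm g hg) hν (hint g hg ν hν)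
      fun μ hμ => h g hg μ hμ ν hν

lemma lowerBound_singleton (g : Ω → ℝ) (ε : ℝ) :
    lowerBound φ {g} N N ε = ⨅ (ν ∈ N) (μ ∈ N)
      (_ : ∫ ω, g ω ∂(μ : Measure Ω) - ∫ ω, g ω ∂(ν : Measure Ω) = ε),
      (phiDiv φ (μ : Measure Ω) (ν : Measure Ω) : EReal) := by
  simp only [lowerBound, iSup_singleton, iInf_singleton, EReal.coe_eq_coe_iff, ite_self]

lemma conj_iInf_lowerBound (hφ : IsDivergenceGenerator φ) (hmix : IsMixClosed N)
    (hden : IsDensityClosed N) (hGm : ∀ g ∈ G, Measurable g)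
    (hint : ∀ g ∈ G, ∀ ν ∈ N, Integrable g (ν : Measure Ω)) :
    conj (fun ε => ⨅ g ∈ G, lowerBound φ {g} N N ε) = cgfSup φ G N := by
  ext t
  have hK := (cgfSup_le_iff hφ hmix hden hGm hint (t := t)).1 le_rfl
  refine le_antisymm (iSup_le fun ε => ?_)
    ((cgfSup_le_iff hφ hmix hden hGm hint).2 fun g hg μ hμ ν hν => ?_)
  · rw [coe_sub_le_comm]
    refine le_iInf₂ fun g hg => ?_
    rw [lowerBound_singleton]
    refine le_iInf₂ fun ν hν => le_iInf₂ fun μ hμ => le_iInf fun h => ?_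
    rw [coe_sub_le_comm, ← h]
    exact hK g hg μ hμ ν hν
  · set m := ∫ ω, g ω ∂(μ : Measure Ω) - ∫ ω, g ω ∂(ν : Measure Ω) with hm
    refine le_trans (EReal.sub_le_sub le_rfl ?_)
      (le_iSup (fun ε : ℝ => ((t * ε : ℝ) : EReal) - ⨅ g ∈ G, lowerBound φ {g} N N ε) m)
    refine (iInf₂_le g hg).trans ?_
    rw [lowerBound_singleton]
    exact iInf₂_le_of_le ν hν (iInf₂_le_of_le μ hμ (iInf_le_of_le hm.symm le_rfl))

/-- For t > 0 the bound passes to the supremum; for t ≤ 0 any single x ≤ ε suffices, as tε ≤ tx. -/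
lemma coe_mul_sub_le_of_isLUB {s : Set ℝ} (hs : s.Nonempty) {t ε : ℝ} (hε : IsLUB s ε)
    {D : ℝ≥0∞} {K : EReal} (h : ∀ x ∈ s, ((t * x : ℝ) : EReal) - D ≤ K) :
    ((t * ε : ℝ) : EReal) - D ≤ K := by
  by_cases hD : D = ⊤
  · simp [hD]
  rw [← EReal.coe_ennreal_toReal hD] at h ⊢
  simp_rw [← EReal.coe_sub] at h ⊢
  obtain ⟨x₀, hx₀⟩ := hs
  induction K with
  | top => exact le_top
  | bot => exact absurd (h x₀ hx₀) (not_le.2 (EReal.bot_lt_coe _))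
  | coe k =>
    simp_rw [EReal.coe_le_coe_iff] at h ⊢
    rcases le_or_gt t 0 with ht | ht
    · linarith [h x₀ hx₀, mul_le_mul_of_nonpos_left (hε.1 hx₀) ht]
    · have : ε ≤ (k + D.toReal) / t := hε.2 fun x hx => by
        rw [le_div_iff₀ ht]
        linarith [h x hx]
      rw [le_div_iff₀ ht] at this
      linarith

lemma coe_mul_sub_le_of_isGLB {s : Set ℝ} (hs : s.Nonempty) {t ε : ℝ} (hε : IsGLB s ε)
    {D : ℝ≥0∞} {K : EReal} (h : ∀ x ∈ s, ((t * x : ℝ) : EReal) - D ≤ K) :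
    ((t * ε : ℝ) : EReal) - D ≤ K := by
  have := coe_mul_sub_le_of_isLUB (t := -t) hs.neg hε.neg (D := D) (K := K) fun x hx => by
    simpa using h (-x) hx
  simpa using this

lemma isLUB_of_iSup_coe_eq {ι : Type*} {G : Set ι} {x : ι → ℝ} {ε : ℝ}
    (h : ⨆ g ∈ G, (x g : EReal) = ε) : (x '' G).Nonempty ∧ IsLUB (x '' G) ε := by
  refine ⟨?_, ?_, fun c hc => ?_⟩
  · rw [image_nonempty, nonempty_iff_ne_empty]
    rintro rfl
    simp at h
  · rintro _ ⟨g, hg, rfl⟩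
    rw [← EReal.coe_le_coe_iff, ← h]
    exact le_iSup₂ (f := fun g (_ : g ∈ G) => (x g : EReal)) g hg
  · rw [← EReal.coe_le_coe_iff, ← h]
    exact iSup₂_le fun g hg => EReal.coe_le_coe_iff.2 (hc ⟨g, hg, rfl⟩)

lemma isGLB_of_iInf_coe_eq {ι : Type*} {G : Set ι} {x : ι → ℝ} {ε : ℝ}
    (h : ⨅ g ∈ G, (x g : EReal) = ε) : (x '' G).Nonempty ∧ IsGLB (x '' G) ε := by
  refine ⟨?_, ?_, fun c hc => ?_⟩
  · rw [image_nonempty, nonempty_iff_ne_empty]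
    rintro rfl
    simp at h
  · rintro _ ⟨g, hg, rfl⟩
    rw [← EReal.coe_le_coe_iff, ← h]
    exact iInf₂_le (f := fun g (_ : g ∈ G) => (x g : EReal)) g hg
  · rw [← EReal.coe_le_coe_iff, ← h]
    exact le_iInf₂ fun g hg => EReal.coe_le_coe_iff.2 (hc ⟨g, hg, rfl⟩)

/-- A pair seen by `lowerBound` has an extremal mean difference ε, and bounds for the single
functions pass to it. Conversely, a triple (g, μ, ν) is dominated by the conjugate at an ε with tε ≥
t(μ(g) - ν(g)). -/
lemma conj_lowerBound (hφ : IsDivergenceGenerator φ) (hmix : IsMixClosed N)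
    (hden : IsDensityClosed N) (hGm : ∀ g ∈ G, Measurable g)
    (hint : ∀ g ∈ G, ∀ ν ∈ N, Integrable g (ν : Measure Ω))
    (hipm : ∀ μ ∈ N, ∀ ν ∈ N, phiDiv φ (μ : Measure Ω) (ν : Measure Ω) ≠ ⊤ →
      ipm G (μ : Measure Ω) (ν : Measure Ω) ≠ ⊤) :
    conj (lowerBound φ G N N) = cgfSup φ G N := by
  ext t
  have hK := (cgfSup_le_iff hφ hmix hden hGm hint (t := t)).1 le_rfl
  refine le_antisymm (iSup_le fun ε => ?_)
    ((cgfSup_le_iff hφ hmix hden hGm hint).2 fun g hg μ hμ ν hν => ?_)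
  · rw [coe_sub_le_comm, lowerBound]
    split_ifs
    all_goals
      refine le_iInf₂ fun ν hν => le_iInf₂ fun μ hμ => le_iInf fun h => ?_
      rw [coe_sub_le_comm]
    · obtain ⟨hne, hlub⟩ := isLUB_of_iSup_coe_eq h
      refine coe_mul_sub_le_of_isLUB hne hlub ?_
      rintro _ ⟨g, hg, rfl⟩
      exact hK g hg μ hμ ν hν
    · obtain ⟨hne, hglb⟩ := isGLB_of_iInf_coe_eq h
      refine coe_mul_sub_le_of_isGLB hne hglb ?_
      rintro _ ⟨g, hg, rfl⟩
      exact hK g hg μ hμ ν hν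
  · let m : (Ω → ℝ) → ℝ := fun g => ∫ ω, g ω ∂(μ : Measure Ω) - ∫ ω, g ω ∂(ν : Measure Ω)
    change ((t * m g : ℝ) : EReal) - _ ≤ _
    by_cases hD : phiDiv φ (μ : Measure Ω) (ν : Measure Ω) = ⊤
    · simp [hD]
    have hconj : ∀ ε : ℝ, t * m g ≤ t * ε →
        lowerBound φ G N N ε ≤ (phiDiv φ (μ : Measure Ω) (ν : Measure Ω) : EReal) →
        ((t * m g : ℝ) : EReal) - (phiDiv φ (μ : Measure Ω) (ν : Measure Ω) : EReal)
          ≤ conj (lowerBound φ G N N) t := fun ε hε hle =>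
      le_trans (EReal.sub_le_sub (EReal.coe_le_coe_iff.2 hε) hle)
        (le_iSup (fun ε : ℝ => ((t * ε : ℝ) : EReal) - lowerBound φ G N N ε) ε)
    -- A finite IPM bounds all mean differences, so the extremal ones are real and occur as
    -- arguments of the lower bound function.
    have hb := hipm μ hμ ν hν hD
    rw [ipm_eq (fun g hg => hint g hg μ hμ) (fun g hg => hint g hg ν hν)] at hb
    obtain ⟨b, hb'⟩ : ∃ b : ℝ≥0, (b : ℝ≥0∞) = _ := ⟨_, ENNReal.coe_toNNReal hb⟩
    have hmb : ∀ g ∈ G, |m g| ≤ b := fun g hg => by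
      have : ((Real.nnabs (m g) : ℝ≥0) : ℝ≥0∞) ≤ b := by
        rw [hb']
        exact le_iSup₂ (f := fun g (_ : g ∈ G) => ((Real.nnabs (m g) : ℝ≥0) : ℝ≥0∞)) g hg
      rw [← Real.coe_nnabs]
      exact_mod_cast this
    rcases le_or_gt (t * m g) 0 with htm | htm
    -- When t·m(g) ≤ 0 the trivial pair (ν, ν), with ε = 0 and zero divergence, already does at
    -- least as well.
    · refine hconj 0 (by simpa using htm) ?_
      rw [lowerBound, if_pos le_rfl]
      refine iInf₂_le_of_le ν hν (iInf₂_le_of_le ν hν (iInf_le_of_le ?_ ?_))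
      · simp [biSup_const (show G.Nonempty from ⟨g, hg⟩)]
      · rw [phiDiv_self hφ]
        simpa using EReal.coe_ennreal_nonneg _
    -- For t > 0 the supremum is at least m(g) > 0, and for t < 0 the infimum is at most m(g) < 0,
    -- so the sign of ε selects the matching branch of `lowerBound`.
    · rcases pos_and_pos_or_neg_and_neg_of_mul_pos htm with ⟨ht, hm⟩ | ⟨ht, hm⟩
      · have h1 : (m g : EReal) ≤ ⨆ g ∈ G, (m g : EReal) :=
          le_iSup₂ (f := fun g (_ : g ∈ G) => (m g : EReal)) g hg
        have h2 : ⨆ g ∈ G, (m g : EReal) ≤ (b : ℝ) :=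
          iSup₂_le fun g hg => EReal.coe_le_coe_iff.2 ((le_abs_self _).trans (hmb g hg))
        obtain ⟨ε, hε⟩ : ∃ ε : ℝ, ⨆ g ∈ G, (m g : EReal) = ε :=
          ⟨_, (EReal.coe_toReal (ne_top_of_le_ne_top (EReal.coe_ne_top _) h2)
            (ne_bot_of_le_ne_bot (EReal.coe_ne_bot _) h1)).symm⟩
        rw [hε, EReal.coe_le_coe_iff] at h1
        refine hconj ε (mul_le_mul_of_nonneg_left h1 ht.le) ?_
        rw [lowerBound, if_pos (hm.le.trans h1)]
        exact iInf₂_le_of_le ν hν (iInf₂_le_of_le μ hμ (iInf_le_of_le hε le_rfl))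
      · have h1 : ⨅ g ∈ G, (m g : EReal) ≤ m g :=
          iInf₂_le (f := fun g (_ : g ∈ G) => (m g : EReal)) g hg
        have h2 : ((-b : ℝ) : EReal) ≤ ⨅ g ∈ G, (m g : EReal) :=
          le_iInf₂ fun g hg => EReal.coe_le_coe_iff.2 (neg_le_of_abs_le (hmb g hg))
        obtain ⟨ε, hε⟩ : ∃ ε : ℝ, ⨅ g ∈ G, (m g : EReal) = ε :=
          ⟨_, (EReal.coe_toReal (ne_top_of_le_ne_top (EReal.coe_ne_top _) h1)
            (ne_bot_of_le_ne_bot (EReal.coe_ne_bot _) h2)).symm⟩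
        rw [hε, EReal.coe_le_coe_iff] at h1
        refine hconj ε (mul_le_mul_of_nonpos_left h1 ht.le) ?_
        rw [lowerBound, if_neg (by linarith)]
        exact iInf₂_le_of_le ν hν (iInf₂_le_of_le μ hμ (iInf_le_of_le hε le_rfl))

end conjugate

/-! ### Probability measures in a decomposable pair -/

section probIn

variable {X : Submodule ℝ (SignedMeasure Ω)} {Y : Submodule ℝ (Ω → ℝ)}

lemma isMixClosed_probIn : IsMixClosed (probIn X) := by
  intro μ hμ ν hν s _ _ η hη
  have h : (η : Measure Ω).toSignedMeasure =
      ((1 - s).toNNReal • (ν : Measure Ω) + s.toNNReal • (μ : Measure Ω)).toSignedMeasure :=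
    Measure.toSignedMeasure_congr hη
  rw [Measure.toSignedMeasure_add, Measure.toSignedMeasure_smul, Measure.toSignedMeasure_smul] at h
  change (η : Measure Ω).toSignedMeasure ∈ X
  rw [h]
  exact X.add_mem (X.smul_mem ((1 - s).toNNReal : ℝ) hν) (X.smul_mem (s.toNNReal : ℝ) hμ)

/-- This is where decomposability enters: X contains the competitors with bounded density that
strong duality requires. -/
lemma isDensityClosed_probIn
    (hX : ∀ ν ∈ probIn X, IsDecomposable X Y (ν : Measure Ω)) : IsDensityClosed (probIn X) := by
  intro ν hν f hf hf0 ⟨M, hM⟩ μ hμ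
  have hfin : ∫⁻ ω, ENNReal.ofReal (f ω) ∂(ν : Measure Ω) ≠ ⊤ := by
    have : (μ : Measure Ω) univ ≠ ⊤ := measure_ne_top _ _
    rwa [hμ, withDensity_apply _ MeasurableSet.univ, Measure.restrict_univ] at this
  have h := withDensityᵥ_toReal hf.ennreal_ofReal.aemeasurable hfin
  simp only [ENNReal.toReal_ofReal (hf0 _)] at h
  have hmem := (hX ν hν).bounded_density_mem f
    (memLp_top_of_bound hf.aestronglyMeasurable M (ae_of_all _ fun ω => by
      rw [Real.norm_of_nonneg (hf0 ω)]; exact hM ω))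
  have := isFiniteMeasure_withDensity hfin
  change (μ : Measure Ω).toSignedMeasure ∈ X
  rw [Measure.toSignedMeasure_congr hμ, ← h]
  exact hmem

lemma IsDualPair.integrable_of_mem_probIn (hXY : IsDualPair X Y) {g : Ω → ℝ} (hg : g ∈ Y)
    {ν : ProbabilityMeasure Ω} (hν : ν ∈ probIn X) : Integrable g (ν : Measure Ω) := by
  have := hXY.integrable _ hν g hg
  rwa [Measure.variation_toSignedMeasure] at this

end probIn

end OptimalIPM

/-! ### The main theorem -/

theorem mainTheorem8 {Ω : Type*} [MeasurableSpace Ω] (φ : ℝ → EReal)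
    (hφ : IsDivergenceGenerator φ) :
    -- the conjugate of the optimal lower bound
    (∀ (X : Submodule ℝ (SignedMeasure Ω)) (Y : Submodule ℝ (Ω → ℝ)),
      IsDualPair X Y →
      (∀ ν ∈ probIn X, IsDecomposable X Y (ν : Measure Ω)) →
      ∀ G : Set (Ω → ℝ), G ⊆ (Y : Set (Ω → ℝ)) →
        conj
            (fun ε => ⨅ g ∈ G,
              lowerBound φ {g} (probIn X) (probIn X) ε)
          = cgfSup φ G (probIn X) ∧
        ((∀ μ ∈ probIn X, ∀ ν ∈ probIn X,
            phiDiv φ (μ : Measure Ω) (ν : Measure Ω) ≠ ⊤ →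
            ipm G (μ : Measure Ω) (ν : Measure Ω) ≠ ⊤) →
          conj
              (lowerBound φ G (probIn X) (probIn X))
            = cgfSup φ G (probIn X))) ∧
    -- the operational form
    (∀ (S : SigmaIdeal Ω) (G : Set (Ω → ℝ)), G.Nonempty → (∀ g ∈ G, Measurable g) →
      (∀ L : ℝ≥0 → EReal, ConvexNNReal L → LowerSemicontinuous L →
        (IPMBound φ (probIntegrating S G) G L ↔
          MeanDeviationBound φ (probIntegrating S G) G L) ∧
        (MeanDeviationBound φ (probIntegrating S G) G L →
          CgfBound φ (probIntegrating S G) G L) ∧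
        ((∀ x, L x ≠ ⊥) → (Monotone L ∨ L 0 ≤ 0) →
          CgfBound φ (probIntegrating S G) G L →
          IPMBound φ (probIntegrating S G) G L)) ∧
      -- the quadratic case: Pinsker's inequality for `φ`-subgaussian classes
      ((∀ μ ∈ probIntegrating S G, ∀ ν ∈ probIntegrating S G,
          ipm G (μ : Measure Ω) (ν : Measure Ω) ^ 2 / 2
            ≤ phiDiv φ (μ : Measure Ω) (ν : Measure Ω)) ↔
        ∀ t : ℝ, ∀ g ∈ G, ∀ ν ∈ probIntegrating S G,
          cgf φ g (ν : Measure Ω) t ≤ ((t ^ 2 / 2 : ℝ) : EReal))) := by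
  refine ⟨fun X Y hXY hX G hG => ?_, fun S G hG hGm => ?_⟩
  · have hGm : ∀ g ∈ G, Measurable g := fun g hg => hXY.measurable g (hG hg)
    have hint : ∀ g ∈ G, ∀ ν ∈ probIn X, Integrable g (ν : Measure Ω) := fun g hg ν hν =>
      hXY.integrable_of_mem_probIn (hG hg) hν
    exact ⟨conj_iInf_lowerBound hφ isMixClosed_probIn (isDensityClosed_probIn hX) hGm hint,
      conj_lowerBound hφ isMixClosed_probIn (isDensityClosed_probIn hX) hGm hint⟩
  · have hback : ∀ L : ℝ≥0 → EReal, ConvexNNReal L → LowerSemicontinuous L → (∀ x, L x ≠ ⊥) →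
        (Monotone L ∨ L 0 ≤ 0) → CgfBound φ (probIntegrating S G) G L →
        IPMBound φ (probIntegrating S G) G L := fun L hL hlsc hbot hmono h =>
      ipmBound_of_meanDeviationBound hG hlsc
        (meanDeviationBound_of_cgfBound hφ hGm hL hlsc hbot hmono h)
    refine ⟨fun L hL hlsc => ⟨⟨meanDeviationBound_of_ipmBound hφ hL,
      ipmBound_of_meanDeviationBound hG hlsc⟩, cgfBound_of_meanDeviationBound hφ hGm,
      hback L hL hlsc⟩, ?_⟩
    set Q : ℝ≥0 → EReal := fun x => (((x : ℝ) ^ 2 / 2 : ℝ) : EReal) with hQ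
    have hI : (∀ μ ∈ probIntegrating S G, ∀ ν ∈ probIntegrating S G,
          ipm G (μ : Measure Ω) (ν : Measure Ω) ^ 2 / 2
            ≤ phiDiv φ (μ : Measure Ω) (ν : Measure Ω)) ↔
        IPMBound φ (probIntegrating S G) G Q := by
      simp only [IPMBound, hQ, extendTop_quadratic, EReal.coe_ennreal_le_coe_ennreal_iff]
    have hC : (∀ t : ℝ, ∀ g ∈ G, ∀ ν ∈ probIntegrating S G,
          cgf φ g (ν : Measure Ω) t ≤ ((t ^ 2 / 2 : ℝ) : EReal)) ↔
        CgfBound φ (probIntegrating S G) G Q := by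
      simp only [CgfBound, hQ, conjNNReal_quadratic (abs_nonneg _), sq_abs]
    rw [hI, hC]
    refine ⟨fun h => cgfBound_of_meanDeviationBound hφ hGm
      (meanDeviationBound_of_ipmBound hφ convexNNReal_quadratic h),
      hback Q convexNNReal_quadratic continuous_quadratic.lowerSemicontinuous
        (fun x => EReal.coe_ne_bot _) (Or.inr (by simp [hQ]))⟩
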